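/- **Theorem (Flow Reduction Theorem).** Let $\Sigma=(V,E,\sigma)$ be a finite signed graph (loops and multiple edges allowed, $\sigma:E\to\{1,-1\}$) with an orientation $\varepsilon$: each edge $e$ carries at each of its two ends $u,v$ an arrow $\varepsilon(u,e),\varepsilon(v,e)\in\{1,-1\}$ ($+1$ if it points away from the vertex) with $\varepsilon(u,e)\varepsilon(v,e)=-\sigma(e)$; a loop has two ends at the same vertex. Let $f:E\to\mathbb Z$ be a nontrivial integral flow of $(\Sigma,\varepsilon)$, i.e. $f\ne 0$ and for every vertex $v$ the sum of $\varepsilon(u,e)f(e)$ over all edges $e$ and ends $u$ of $e$ with $u=v$ is $0$. Let $\varepsilon_f$ be the orientation that equals $-\varepsilon$ on the edges with $f(e)<0$ and $\varepsilon$ on the other edges, and let $[\varepsilon,\varepsilon_f](e)=\varepsilon(v,e)\varepsilon_f(v,e)$ for an end $v$ of $e$. Then there are finitely many minimal directed Eulerian walks $(W_i,\varepsilon_f)$ and Eulerian cycle-trees $T_i=\Sigma(W_i)$ such that $$f=\sum_i f_{(W_i,\varepsilon_f)}=\sum_i[\varepsilon,\varepsilon_f]\cdot I_{T_i}.$$ If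 moreover $f$ is indecomposable (there are no nontrivial integral flows $f_1,f_2$ with $f=f_1+f_2$ and $f_1(e)f_2(e)\ge 0$ for all $e$), then there are a single minimal directed Eulerian walk $(W,\varepsilon_f)$ and Eulerian cycle-tree $T=\Sigma(W)$ with $f=f_{(W,\varepsilon_f)}=[\varepsilon,\varepsilon_f]\cdot I_T$. *Walks.* A direction of a walk $W=u_0x_1u_1\cdots x_nu_n$ ($n\ge1$) assigns to each occurrence $x_i$ values $\varepsilon_W(u_{i-1},x_i),\varepsilon_W(u_i,x_i)\in\{1,-1\}$ with product $-\sigma(x_i)$ and with $\varepsilon_W(u_i,x_i)+\varepsilon_W(u_i,x_{i+1})=0$ for $1\le i<n$. The pair $(W,\varepsilon_W)$ is a directed closed walk if also $u_0=u_n$ and $\varepsilon_W(u_0,x_1)+\varepsilon_W(u_n,x_n)=0$. An Eulerian walk is a closed walk with $\prod_i\sigma(x_i)=1$ whose directions agree on all occurrences of the same edge; a directed Eulerian walk $(W,\varepsilon_W)$ is an Eulerian walk with a direction making it a directed closed walk. It is minimal if there is no directed Eulerian walk $(W',\varepsilon_{W'})$ such that the edge multiset of $W'$ is properly contained in that of $W$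 and $\varepsilon_{W'}$ agrees with $\varepsilon_W$ on the edges of $W'$. Writing $(W,\varepsilon_f)$ means that $\varepsilon_f$ restricted to $W$ is the direction. The characteristic vector is $f_{(W,\varepsilon_W)}(x)=\sum_{i:\,x_i=x}\varepsilon(v,x)\,\varepsilon_W(v,x_i)$, where $v$ is an end of $x$. $\Sigma(W)$ is the subgraph formed by the edges of $W$ and their end-vertices. *Cycle-trees.* A cycle is a simple closed path (a loop is a cycle of length $1$), balanced if the product of its signs is $1$ and unbalanced otherwise. A cycle-tree is a connected subgraph $T$ decomposed into edge-disjoint cycles $C_i$ (block cycles) and vertex-disjoint simple paths $P_j$, possibly of length zero (block paths), such that: $\{C_i\}$ is the set of all cycles in $T$; two distinct cycles meet in at most one vertex, and such a vertex is a block path of length zero; each $P_j$ meets exactly two cycles, one exactly in the initial vertex and the other exactly in the terminal vertex of $P_j$; each intersection vertex (a common vertex of two block cycles, or an initial or terminal vertex of a block path) is a cut-point, i.e. deleting that point from $T$, as a $1$-dimensional complex, increases the number of components. $T$ is Eulerian if each balanced block cycle has an even number and each unbalanced block cycle an odd number of intersection vertices. Its indicator $I_T$ is $1$ on edges of block cycles,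 $2$ on edges of block paths, and $0$ elsewhere. -/

import Mathlib

/-- A signed graph, loops and multiple edges allowed. Every edge `e` (loops included) has two
ends, labelled by `Bool`; `ends e b` is the vertex at the end `b`, so that the multiset of
end-vertices of `e` is `{ends e false, ends e true}`. The labels only serve to tell the two ends
of a loop apart. -/
structure SignedGraph (V E : Type*) where
  ends : E → Bool → V
  sign : E → ℤˣ

namespace SignedGraph

variable {V E : Type*}

/-- An orientation: an arrow at each of the two ends of every edge, `+1` if it points away from
the vertex at that end and `-1` if it points toward it. The arrows of a positive edge are
in the same direction (opposite values), those of a negative edge in opposite directions. -/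
structure Orientation (G : SignedGraph V E) where
  val : E → Bool → ℤˣ
  mul_eq : ∀ e, val e false * val e true = -G.sign e

/-- The coupling `[ε₁, ε₂](e) = ε₁(v, e) ε₂(v, e)` of two orientations of the whole graph. -/
def coupling {G : SignedGraph V E} (ε₁ ε₂ : G.Orientation) (e : E) : ℤ :=
  ((ε₁.val e false * ε₂.val e false : ℤˣ) : ℤ)

/-- The coupling may be computed at either end of the edge. -/
theorem coupling_eq {G : SignedGraph V E} (ε₁ ε₂ : G.Orientation) (e : E) (b : Bool) :
    coupling ε₁ ε₂ e = ((ε₁.val e b * ε₂.val e b : ℤˣ) : ℤ) := by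
  have h₁ := ε₁.mul_eq e
  have h₂ := ε₂.mul_eq e
  unfold coupling
  cases b
  · rfl
  · rcases Int.units_eq_one_or (ε₁.val e false) with a | a <;>
    rcases Int.units_eq_one_or (ε₁.val e true) with b | b <;>
    rcases Int.units_eq_one_or (ε₂.val e false) with c | c <;>
    rcases Int.units_eq_one_or (ε₂.val e true) with d | d <;>
    rcases Int.units_eq_one_or (G.sign e) with s | s <;>
    simp_all

/-- The boundary operator: the sum of `ε(u, e) f(e)` over all edges `e` and all ends `u` of `e`
(counted with multiplicity) with `u = v`. -/
def boundary [Fintype E] [DecidableEq V] {G : SignedGraph V E} (ε : G.Orientation)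
    (f : E → ℤ) (v : V) : ℤ :=
  ∑ e, ∑ b, if G.ends e b = v then (ε.val e b : ℤ) * f e else 0

/-- Integral flows of `(G, ε)`. -/
def IsFlow [Fintype E] [DecidableEq V] {G : SignedGraph V E} (ε : G.Orientation)
    (f : E → ℤ) : Prop :=
  ∀ v, boundary ε f v = 0

/-- Nontrivial integral flows: those with nonempty support. -/
def IsNontrivialFlow [Fintype E] [DecidableEq V] {G : SignedGraph V E} (ε : G.Orientation)
    (f : E → ℤ) : Prop :=
  IsFlow ε f ∧ ∃ e, f e ≠ 0

def IsDecomposable [Fintype E] [DecidableEq V] {G : SignedGraph V E} (ε : G.Orientation)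
    (f : E → ℤ) : Prop :=
  ∃ f₁ f₂ : E → ℤ, IsNontrivialFlow ε f₁ ∧ IsNontrivialFlow ε f₂ ∧
    f = f₁ + f₂ ∧ ∀ e, 0 ≤ f₁ e * f₂ e

def IsIndecomposable [Fintype E] [DecidableEq V] {G : SignedGraph V E} (ε : G.Orientation)
    (f : E → ℤ) : Prop :=
  IsNontrivialFlow ε f ∧ ¬ IsDecomposable ε f

/-- The orientation `ε_f`: reverse `ε` on the edges where `f` is negative. -/
def flowOrientation {G : SignedGraph V E} (ε : G.Orientation) (f : E → ℤ) : G.Orientation where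
  val e b := if f e < 0 then -ε.val e b else ε.val e b
  mul_eq e := by
    have h := ε.mul_eq e
    by_cases hf : f e < 0 <;> simp [hf, h]

section Walks

/-! A step `(e, b)` traverses the edge `e` starting from its end `b` and arriving at its other
end. A walk of positive length `u₀x₁u₁⋯xₙuₙ` is the list of its `n` steps. -/

def source (G : SignedGraph V E) (d : E × Bool) : V := G.ends d.1 d.2

def target (G : SignedGraph V E) (d : E × Bool) : V := G.ends d.1 (!d.2)

/-- Consecutive steps fit together. -/
def IsWalk (G : SignedGraph V E) (W : List (E × Bool)) : Prop :=
  W.IsChain fun d d' => G.target d = G.source d'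

/-- Closed walks (of positive length). -/
def IsClosedWalk (G : SignedGraph V E) (W : List (E × Bool)) : Prop :=
  G.IsWalk W ∧ ∃ h : W ≠ [], G.source (W.head h) = G.target (W.getLast h)

def walkSign (G : SignedGraph V E) (W : List (E × Bool)) : ℤˣ :=
  (W.map fun d => G.sign d.1).prod

/-- The multiset of edges of a walk. -/
def edgeMultiset (W : List (E × Bool)) : Multiset E := (W.map Prod.fst : List E)

/-- The set of edges of a walk. -/
def walkSupport [DecidableEq E] (W : List (E × Bool)) : Finset E := (W.map Prod.fst).toFinset

/-- Directions of a walk: `δ i b` is the arrow that the `i`-th edge of the walk, in its `i`-th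
occurrence, carries at its end `b`. The two arrows on each occurrence obey the sign rule, and the
arrow with which the walk enters a midway vertex is opposite to the one with which it leaves. -/
def IsDirection (G : SignedGraph V E) (W : List (E × Bool))
    (δ : Fin W.length → Bool → ℤˣ) : Prop :=
  (∀ i, δ i false * δ i true = -G.sign (W.get i).1) ∧
  ∀ i j : Fin W.length, i.val + 1 = j.val → δ i (!(W.get i).2) = -δ j (W.get j).2

/-- Directed closed walks: the direction condition also holds at `u₀ = uₙ`. -/
def IsDirectedClosedWalk (G : SignedGraph V E) (W : List (E × Bool))
    (δ : Fin W.length → Bool → ℤˣ) : Prop :=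
  G.IsClosedWalk W ∧ G.IsDirection W δ ∧
  ∀ i j : Fin W.length, i.val = 0 → j.val + 1 = W.length →
    δ j (!(W.get j).2) = -δ i (W.get i).2

/-- Eulerian walks: balanced closed walks whose directions have the same orientation on repeated
edges. -/
def IsEulerianWalk (G : SignedGraph V E) (W : List (E × Bool)) : Prop :=
  G.IsClosedWalk W ∧ G.walkSign W = 1 ∧
  ∀ δ, G.IsDirection W δ → ∀ i j, (W.get i).1 = (W.get j).1 → δ i = δ j

def IsDirectedEulerianWalk (G : SignedGraph V E) (W : List (E × Bool))
    (δ : Fin W.length → Bool → ℤˣ) : Prop :=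
  G.IsEulerianWalk W ∧ G.IsDirectedClosedWalk W δ

/-- `(W', δ')` is properly contained in `(W, δ)`: proper containment of edge multisets, the two
directions being the same on the common edges. -/
def ProperlyContained (W' : List (E × Bool)) (δ' : Fin W'.length → Bool → ℤˣ)
    (W : List (E × Bool)) (δ : Fin W.length → Bool → ℤˣ) : Prop :=
  edgeMultiset W' < edgeMultiset W ∧
  ∀ i j, (W'.get i).1 = (W.get j).1 → δ' i = δ j

/-- Minimal directed Eulerian walks: no directed Eulerian walk is properly contained. -/
def IsMinimalDirectedEulerianWalk (G : SignedGraph V E) (W : List (E × Bool))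
    (δ : Fin W.length → Bool → ℤˣ) : Prop :=
  G.IsDirectedEulerianWalk W δ ∧
  ∀ W' δ', G.IsDirectedEulerianWalk W' δ' → ¬ ProperlyContained W' δ' W δ

/-- The arrows that an orientation of the graph puts on the edges of a walk. -/
def Orientation.onWalk {G : SignedGraph V E} (ε : G.Orientation) (W : List (E × Bool)) :
    Fin W.length → Bool → ℤˣ :=
  fun i => ε.val (W.get i).1

/-- The characteristic vector `x ↦ ∑_{xᵢ = x} [ε, ε_W](xᵢ)` of a directed closed walk. -/
def charVector [DecidableEq E] {G : SignedGraph V E} (ε : G.Orientation)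
    (W : List (E × Bool)) (δ : Fin W.length → Bool → ℤˣ) (x : E) : ℤ :=
  ∑ i, if (W.get i).1 = x then ((ε.val x false * δ i false : ℤˣ) : ℤ) else 0

end Walks

section CycleTrees

/-! A subgraph without isolated vertices is given by its set of edges. -/

def IsEnd (G : SignedGraph V E) (v : V) (e : E) : Prop := ∃ b, G.ends e b = v

/-- The vertices of the subgraph with edge set `S`. -/
def verts (G : SignedGraph V E) (S : Finset E) : Set V := {v | ∃ e ∈ S, G.IsEnd v e}

/-- The (open) edges `e` and `e'` are in the same component of the subgraph `S`, regarded as a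
one-dimensional complex, after the points of `X` have been removed. -/
def Linked (G : SignedGraph V E) (S : Finset E) (X : Set V) : E → E → Prop :=
  Relation.ReflTransGen fun a b => a ∈ S ∧ b ∈ S ∧ ∃ w, w ∉ X ∧ G.IsEnd w a ∧ G.IsEnd w b

def IsConnected (G : SignedGraph V E) (S : Finset E) : Prop :=
  S.Nonempty ∧ ∀ e ∈ S, ∀ e' ∈ S, G.Linked S ∅ e e'

/-- Cut-points of the subgraph `S`, as a one-dimensional complex: removing the point `v` splits a
component. In particular the vertex of a loop is a cut-point if it lies on a further edge. -/
def IsCutPoint (G : SignedGraph V E) (S : Finset E) (v : V) : Prop :=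
  ∃ e ∈ S, ∃ e' ∈ S, G.Linked S ∅ e e' ∧ ¬ G.Linked S {v} e e'

/-- `C` is the edge set of a cycle, that is, of a simple closed path (loops are cycles of
length `1`, and two parallel edges form a cycle of length `2`). -/
def IsCycle [DecidableEq E] (G : SignedGraph V E) (C : Finset E) : Prop :=
  ∃ W, G.IsClosedWalk W ∧ (W.map G.source).Nodup ∧ (W.map Prod.fst).Nodup ∧ walkSupport W = C

def IsBalancedCycle [DecidableEq E] (G : SignedGraph V E) (C : Finset E) : Prop :=
  G.IsCycle C ∧ ∏ e ∈ C, G.sign e = 1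

def IsUnbalancedCycle [DecidableEq E] (G : SignedGraph V E) (C : Finset E) : Prop :=
  G.IsCycle C ∧ ∏ e ∈ C, G.sign e = -1

/-- The data of a path, possibly of zero length: its initial vertex and its steps. -/
structure PathData (V E : Type*) where
  first : V
  steps : List (E × Bool)

/-- The vertices in the order of the path. -/
def pathVerts (G : SignedGraph V E) (P : PathData V E) : List V :=
  P.first :: P.steps.map G.target

/-- The terminal vertex. -/
def pathLast (G : SignedGraph V E) (P : PathData V E) : V :=
  (G.pathVerts P).getLast (List.cons_ne_nil _ _)

/-- Simple paths: walks from the initial vertex without repeated vertices. -/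
def IsSimplePath (G : SignedGraph V E) (P : PathData V E) : Prop :=
  G.IsWalk P.steps ∧ (∀ h : P.steps ≠ [], G.source (P.steps.head h) = P.first) ∧
  (G.pathVerts P).Nodup

/-- Cycle-trees, together with their decomposition into block cycles and block paths. Block paths
may have zero length: a common vertex of two block cycles is a block path of length zero. -/
structure CycleTree [DecidableEq E] (G : SignedGraph V E) where
  edges : Finset E
  connected : G.IsConnected edges
  /-- the block cycles -/
  cycles : Set (Finset E)
  /-- the block paths -/
  paths : Set (PathData V E)
  paths_simple : ∀ P ∈ paths, G.IsSimplePath P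
  paths_subset : ∀ P ∈ paths, ∀ d ∈ P.steps, d.1 ∈ edges
  cover : ∀ e ∈ edges, (∃ C ∈ cycles, e ∈ C) ∨ ∃ P ∈ paths, e ∈ P.steps.map Prod.fst
  cycles_disjoint : ∀ C ∈ cycles, ∀ C' ∈ cycles, C ≠ C' → Disjoint C C'
  paths_disjoint : ∀ P ∈ paths, ∀ P' ∈ paths, P ≠ P' → ∀ v ∈ G.pathVerts P, v ∉ G.pathVerts P'
  cycles_paths_disjoint : ∀ C ∈ cycles, ∀ P ∈ paths, ∀ e ∈ C, e ∉ P.steps.map Prod.fst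
  /-- the block cycles are all the cycles in the subgraph -/
  mem_cycles_iff : ∀ C, C ∈ cycles ↔ G.IsCycle C ∧ C ⊆ edges
  /-- two cycles meet in at most one vertex -/
  cycles_inter : ∀ C ∈ cycles, ∀ C' ∈ cycles, C ≠ C' → (G.verts C ∩ G.verts C').Subsingleton
  /-- a common vertex of two cycles is a block path of length zero -/
  zero_path : ∀ C ∈ cycles, ∀ C' ∈ cycles, C ≠ C' → ∀ v ∈ G.verts C ∩ G.verts C', ⟨v, []⟩ ∈ paths
  /-- each block path meets exactly two cycles, exactly in its initial and terminal vertices -/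
  paths_inter : ∀ P ∈ paths, ∃ C₁ ∈ cycles, ∃ C₂ ∈ cycles, C₁ ≠ C₂ ∧
    G.verts C₁ ∩ {v | v ∈ G.pathVerts P} = {P.first} ∧
    G.verts C₂ ∩ {v | v ∈ G.pathVerts P} = {G.pathLast P} ∧
    ∀ C ∈ cycles, (G.verts C ∩ {v | v ∈ G.pathVerts P}).Nonempty → C = C₁ ∨ C = C₂
  /-- each intersection vertex is a cut-point -/
  cutPoint : ∀ v, ((∃ C ∈ cycles, ∃ C' ∈ cycles, C ≠ C' ∧ v ∈ G.verts C ∩ G.verts C') ∨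
    ∃ P ∈ paths, v = P.first ∨ v = G.pathLast P) → G.IsCutPoint edges v

variable [DecidableEq E] {G : SignedGraph V E}

/-- Intersection vertices: common vertices of two block cycles, and the initial and terminal
vertices of the block paths. -/
def CycleTree.IsIntersectionVertex (T : CycleTree G) (v : V) : Prop :=
  (∃ C ∈ T.cycles, ∃ C' ∈ T.cycles, C ≠ C' ∧ v ∈ G.verts C ∩ G.verts C') ∨
    ∃ P ∈ T.paths, v = P.first ∨ v = G.pathLast P

/-- The Parity Condition: balanced cycles have an even number of intersection vertices and
unbalanced cycles an odd number. -/
def CycleTree.IsEulerian (T : CycleTree G) : Prop :=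
  ∀ C ∈ T.cycles,
    (G.IsBalancedCycle C → Even {v | v ∈ G.verts C ∧ T.IsIntersectionVertex v}.ncard) ∧
    (G.IsUnbalancedCycle C → Odd {v | v ∈ G.verts C ∧ T.IsIntersectionVertex v}.ncard)

open Classical in
/-- The indicator `I_T`: `1` on block cycles, `2` on block paths, `0` elsewhere. -/
noncomputable def CycleTree.indicator (T : CycleTree G) (e : E) : ℤ :=
  if ∃ C ∈ T.cycles, e ∈ C then 1
  else if ∃ P ∈ T.paths, e ∈ P.steps.map Prod.fst then 2
  else 0

end CycleTrees

end SignedGraph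

/-! Multiplying by the coupling of `ε` and `ε_f` turns `f` into the nonnegative flow `|f|` of `ε_f`.
A nonnegative flow is a sum of nonzero nonnegative flows that are minimal in the pointwise order
(`exists_sum_isMinimalFlow`), and `|f|` is itself minimal when `f` is indecomposable. So it suffices
to realise one minimal flow `g` by a walk and by a cycle-tree.

By conservation, a walk along the arrows that stays below `g` and is not closed can be prolonged
backwards. The total of `g` bounds its length, so some such walk closes (`exists_isCircuit_le`). Its
edge counts form a nonzero flow below `g`, hence equal `g`; a properly contained directed Eulerian
walk would give a smaller flow.

Put the positions of this closed walk on a circle. Two visits to one vertex leave it with opposite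
arrows, since otherwise the arc between them is a smaller flow (`arrow_ne`); hence no vertex is
visited three times. Join the two visits to a vertex by a chord. If two chords crossed, two opposite
arcs out of the four would form a smaller flow (`noncrossing`). The chords therefore cut the disc
into regions, the orbits of `next`, arranged like a tree.

A region is either one edge traversed twice or a cycle. Conversely, a cycle of the graph stays on
one side of every chord whose vertex it visits, so it is a region (`cycle_eq_region`). Maximal runs
of doubled edges are the block paths, and a chord between two cycles is a block path of length zero.
The walk uses cycle edges once and path edges twice, which is the indicator (`cycleTree_indicator`).
Around a cycle the edge signs telescope as products of arrows, up to a factor `-1` for each chord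
met; this is the parity condition (`prod_sign_region`). -/

namespace SignedGraph

open scoped Fin.CommRing

/-! ### Minimal circuits, their chords and their regions. -/

section MinimalCircuits

variable {V E : Type*}

/-- The step that traverses the same edge backwards. -/
def stepRev (d : E × Bool) : E × Bool := (d.1, !d.2)

/-- The arrow at the end from which a step starts. -/
def Orientation.arrow {G : SignedGraph V E} (ε : G.Orientation) (d : E × Bool) : ℤˣ := ε.val d.1 d.2

@[simp] theorem stepRev_stepRev (d : E × Bool) : stepRev (stepRev d) = d := by simp [stepRev]

@[simp] theorem stepRev_fst (d : E × Bool) : (stepRev d).1 = d.1 := rfl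

theorem stepRev_ne (d : E × Bool) : stepRev d ≠ d := by
  intro h
  have := congrArg Prod.snd h
  simp [stepRev] at this

theorem eq_or_eq_stepRev {d d' : E × Bool} (h : d.1 = d'.1) : d = d' ∨ d = stepRev d' := by
  obtain ⟨e, b⟩ := d
  obtain ⟨e', b'⟩ := d'
  simp only at h
  subst h
  cases b <;> cases b' <;> simp [stepRev]

@[simp] theorem source_stepRev (G : SignedGraph V E) (d : E × Bool) :
    G.source (stepRev d) = G.target d := rfl

@[simp] theorem target_stepRev (G : SignedGraph V E) (d : E × Bool) :
    G.target (stepRev d) = G.source d := by simp [stepRev, source, target]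

theorem isEnd_iff {G : SignedGraph V E} {x : V} (d : E × Bool) :
    G.IsEnd x d.1 ↔ G.source d = x ∨ G.target d = x := by
  obtain ⟨e, b⟩ := d
  cases b <;> simp [IsEnd, source, target, or_comm]

theorem arrow_mul_arrow_stepRev {G : SignedGraph V E} (ε : G.Orientation) (d : E × Bool) :
    ε.arrow d * ε.arrow (stepRev d) = -G.sign d.1 := by
  obtain ⟨e, b⟩ := d
  cases b
  · exact ε.mul_eq e
  · simpa [Orientation.arrow, stepRev, mul_comm] using ε.mul_eq e

theorem units_eq_or_eq_neg (a b : ℤˣ) : a = b ∨ a = -b := by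
  rcases Int.units_eq_one_or a with rfl | rfl <;> rcases Int.units_eq_one_or b with rfl | rfl <;>
    simp

theorem units_ne_neg (a : ℤˣ) : a ≠ -a := by
  rcases Int.units_eq_one_or a with rfl | rfl <;> decide

/-- Exchanging the two sums reads the boundary position by position. The set `A` is arbitrary
because unions of arcs are needed as well as arcs. -/
theorem boundary_count [Fintype E] [DecidableEq V] [DecidableEq E] {G : SignedGraph V E}
    (ε : G.Orientation) {ι : Type*} (A : Finset ι) (w : ι → E × Bool) (u : V) :
    boundary ε (fun e => ((A.filter fun i => (w i).1 = e).card : ℤ)) u =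
      ∑ i ∈ A, ((if G.source (w i) = u then (ε.arrow (w i) : ℤ) else 0) +
        (if G.target (w i) = u then (ε.arrow (stepRev (w i)) : ℤ) else 0)) := by
  unfold boundary
  have key : ∀ e, (∑ b, if G.ends e b = u then (ε.val e b : ℤ) *
      ((A.filter fun i => (w i).1 = e).card : ℤ) else 0) =
      ∑ i ∈ A, if (w i).1 = e then
        (∑ b, if G.ends e b = u then (ε.val e b : ℤ) else 0) else 0 := by
    intro e
    rw [eq_comm, ← Finset.sum_filter, Finset.sum_const, nsmul_eq_mul, Finset.mul_sum]
    refine Finset.sum_congr rfl fun b _ => ?_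
    split_ifs <;> ring
  rw [Finset.sum_congr rfl fun e _ => key e, Finset.sum_comm]
  refine Finset.sum_congr rfl fun i _ => ?_
  rw [Finset.sum_ite_eq]
  rcases h : w i with ⟨e, b⟩
  cases b <;> simp [source, target, stepRev, Orientation.arrow, add_comm] <;> rfl

/-- A cyclic sequence of steps along the arrows of `ε`, no proper part of which is a flow. -/
structure IsMinimalCircuit [Fintype E] [DecidableEq V] [DecidableEq E] {G : SignedGraph V E}
    (ε : G.Orientation) {n : ℕ} [NeZero n] (w : Fin n → E × Bool) : Prop where
  target_eq : ∀ i, G.target (w i) = G.source (w (i + 1))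
  arrow_eq : ∀ i, ε.arrow (stepRev (w i)) = -ε.arrow (w (i + 1))
  minimal : ∀ A : Finset (Fin n),
    IsFlow ε (fun e => ((A.filter fun i => (w i).1 = e).card : ℤ)) → A = ∅ ∨ A = Finset.univ

open Classical in
/-- The other position at which the vertex of position `i` is visited, or `i` itself. -/
noncomputable def twin (G : SignedGraph V E) {n : ℕ} (w : Fin n → E × Bool) (i : Fin n) : Fin n :=
  if h : ∃ j, j ≠ i ∧ G.source (w j) = G.source (w i) then h.choose else i

theorem source_twin (G : SignedGraph V E) {n : ℕ} (w : Fin n → E × Bool) (i : Fin n) :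
    G.source (w (twin G w i)) = G.source (w i) := by
  unfold twin
  split_ifs with h
  · exact h.choose_spec.2
  · rfl

theorem twin_ne {G : SignedGraph V E} {n : ℕ} {w : Fin n → E × Bool} {i j : Fin n} (hij : j ≠ i)
    (h : G.source (w j) = G.source (w i)) : twin G w i ≠ i := by
  have h' : ∃ j, j ≠ i ∧ G.source (w j) = G.source (w i) := ⟨j, hij, h⟩
  unfold twin
  rw [dif_pos h']
  exact h'.choose_spec.1

theorem sum_interval_telescope {n : ℕ} [NeZero n] (F : Fin n → ℤ) {i j : Fin n} (hij : i ≤ j) :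
    ∑ k ∈ Finset.Ico i j, (F k - F (k + 1)) = F i - F j := by
  obtain ⟨j, hj⟩ := j
  have hij' : i.val ≤ j := hij
  clear hij
  induction j, hij' using Nat.le_induction with
  | base => simp
  | succ m hm ih =>
    have hm' : m < n := by omega
    have h1 : Finset.Ico i ⟨m + 1, hj⟩ = insert (⟨m, hm'⟩ : Fin n) (Finset.Ico i ⟨m, hm'⟩) := by
      ext k
      simp only [Finset.mem_Ico, Finset.mem_insert, Fin.le_def, Fin.lt_def, Fin.ext_iff]
      omega
    have h2 : (⟨m, hm'⟩ : Fin n) + 1 = ⟨m + 1, hj⟩ := by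
      ext
      rw [Fin.val_add, Fin.val_one']
      simp only
      rw [Nat.mod_eq_of_lt (by omega : 1 < n), Nat.mod_eq_of_lt hj]
    rw [h1, Finset.sum_insert (by simp), ih hm', h2]
    ring

theorem fin_val_succ {n : ℕ} [NeZero n] (k : Fin n) :
    (k.val + 1 < n ∧ (k + 1).val = k.val + 1) ∨ (k.val + 1 = n ∧ (k + 1).val = 0) := by
  have hk := k.isLt
  rcases Nat.lt_or_ge (k.val + 1) n with h | h
  · left
    refine ⟨h, ?_⟩
    rw [Fin.val_add, Fin.val_one', Nat.mod_eq_of_lt (by omega : 1 < n), Nat.mod_eq_of_lt h]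
  · right
    have h' : k.val + 1 = n := by omega
    refine ⟨h', ?_⟩
    rw [Fin.val_add, Fin.val_one', Nat.add_mod_mod, h', Nat.mod_self]

/-- A vertex visited twice splits the circuit; the first of the two positions is on one side. -/
theorem exists_chord {G : SignedGraph V E} {n : ℕ} {w : Fin n → E × Bool} {p : Fin n} (hp : twin G w p ≠ p) :
    ∃ i j, i < j ∧ G.source (w i) = G.source (w j) ∧ G.source (w i) = G.source (w p) ∧
      ((i = p ∧ j = twin G w p) ∨ (i = twin G w p ∧ j = p)) := by
  rcases lt_or_gt_of_ne hp with hlt | hlt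
  · exact ⟨_, _, hlt, source_twin G w p, source_twin G w p, Or.inr ⟨rfl, rfl⟩⟩
  · exact ⟨_, _, hlt, (source_twin G w p).symm, rfl, Or.inl ⟨rfl, rfl⟩⟩

namespace IsMinimalCircuit

variable [Fintype E] [DecidableEq V] [DecidableEq E] {G : SignedGraph V E}
  {ε : G.Orientation} {n : ℕ} [NeZero n] {w : Fin n → E × Bool}

/-- The arrow of arrival is opposite to that of the next departure, so each position gives a
difference and the sum telescopes over an arc. -/
theorem boundary_interval (h : IsMinimalCircuit ε w) (A : Finset (Fin n)) (u : V) :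
    boundary ε (fun e => ((A.filter fun i => (w i).1 = e).card : ℤ)) u =
      ∑ i ∈ A, ((if G.source (w i) = u then (ε.arrow (w i) : ℤ) else 0) -
        (if G.source (w (i + 1)) = u then (ε.arrow (w (i + 1)) : ℤ) else 0)) := by
  rw [boundary_count]
  refine Finset.sum_congr rfl fun i _ => ?_
  rw [h.target_eq, h.arrow_eq, sub_eq_add_neg]
  congr 1
  split_ifs <;> simp

/-- With equal arrows at `i` and `j` the two ends of the arc `[i, j)` would cancel, giving a flow on
a set of positions that contains `i` but not `j`. -/
theorem arrow_ne (h : IsMinimalCircuit ε w) {i j : Fin n} (hij : i ≠ j)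
    (hv : G.source (w i) = G.source (w j)) : ε.arrow (w i) = -ε.arrow (w j) := by
  wlog hlt : i < j generalizing i j
  · rw [this hij.symm hv.symm (lt_of_le_of_ne (not_lt.mp hlt) hij.symm), neg_neg]
  refine (units_eq_or_eq_neg _ _).resolve_left fun ha => ?_
  have := h.minimal (Finset.Ico i j) (fun u => by
    rw [h.boundary_interval]
    rw [sum_interval_telescope
      (fun i => if G.source (w i) = u then (ε.arrow (w i) : ℤ) else 0) hlt.le]
    rw [hv, ha, sub_self])
  rcases this with h0 | h0
  · have : i ∈ Finset.Ico i j := by simpa using hlt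
    rw [h0] at this
    simp at this
  · have : j ∈ Finset.Ico i j := h0 ▸ Finset.mem_univ j
    simp at this

/-- If the chords crossed, `[i, p)` and `[j, q)` together would be a flow: the arrows at `i`, `j`
are opposite, those at `p`, `q` too, so the four end terms cancel. -/
theorem noncrossing (h : IsMinimalCircuit ε w) {i p j q : Fin n} (hip : i < p) (hpj : p < j)
    (hjq : j < q) (hij : G.source (w i) = G.source (w j)) :
    G.source (w p) ≠ G.source (w q) := by
  intro hpq
  have hd : Disjoint (Finset.Ico i p) (Finset.Ico j q) := by
    rw [Finset.disjoint_left]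
    intro a
    simp only [Finset.mem_Ico, Fin.le_def, Fin.lt_def] at *
    omega
  have := h.minimal (Finset.Ico i p ∪ Finset.Ico j q) (fun u => by
    rw [h.boundary_interval, Finset.sum_union hd]
    rw [sum_interval_telescope
      (fun i => if G.source (w i) = u then (ε.arrow (w i) : ℤ) else 0) hip.le,
      sum_interval_telescope
      (fun i => if G.source (w i) = u then (ε.arrow (w i) : ℤ) else 0) hjq.le]
    rw [hij, hpq, h.arrow_ne (hip.trans hpj).ne hij, h.arrow_ne (hpj.trans hjq).ne hpq]
    split_ifs <;> simp)
  rcases this with h0 | h0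
  · have : i ∈ Finset.Ico i p ∪ Finset.Ico j q := by simp [hip]
    rw [h0] at this
    simp at this
  · have : p ∈ Finset.Ico i p ∪ Finset.Ico j q := h0 ▸ Finset.mem_univ p
    simp only [Finset.mem_union, Finset.mem_Ico, Fin.le_def, Fin.lt_def] at *
    omega

/-- Three visits would need three pairwise opposite signs. -/
theorem eq_or_eq_twin (h : IsMinimalCircuit ε w) {i j : Fin n}
    (hv : G.source (w j) = G.source (w i)) : j = i ∨ j = twin G w i := by
  by_contra! hc
  have h1 : twin G w i ≠ i := twin_ne hc.1 hv
  have a1 := h.arrow_ne hc.1 hv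
  have a2 := h.arrow_ne h1 (source_twin G w i)
  have a3 := h.arrow_ne hc.2 (hv.trans (source_twin G w i).symm)
  rw [a1, a2] at a3
  exact units_ne_neg _ a3

theorem twin_twin (h : IsMinimalCircuit ε w) (i : Fin n) : twin G w (twin G w i) = i := by
  rcases h.eq_or_eq_twin (source_twin G w i).symm with h1 | h1
  · rw [← h1, ← h1]
  · exact h1.symm

theorem twin_involutive (h : IsMinimalCircuit ε w) : Function.Involutive (twin G w) := h.twin_twin

theorem twin_ne_self_iff (h : IsMinimalCircuit ε w) {i : Fin n} :
    twin G w (twin G w i) ≠ twin G w i ↔ twin G w i ≠ i := by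
  rw [h.twin_twin]
  exact ne_comm

/-- The successor of a position on the boundary of its region. -/
noncomputable def next (h : IsMinimalCircuit ε w) : Equiv.Perm (Fin n) :=
  (Equiv.addRight 1).trans h.twin_involutive.toPerm

theorem next_apply (h : IsMinimalCircuit ε w) (i : Fin n) : h.next i = twin G w (i + 1) := rfl

theorem source_next (h : IsMinimalCircuit ε w) (i : Fin n) :
    G.source (w (h.next i)) = G.target (w i) := by
  rw [next_apply, source_twin, h.target_eq]

theorem next_sub_one (h : IsMinimalCircuit ε w) (i : Fin n) : h.next (i - 1) = twin G w i := by
  rw [next_apply, sub_add_cancel]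

theorem injective (h : IsMinimalCircuit ε w) : Function.Injective w := by
  intro i j hij
  by_contra hne
  have := h.arrow_ne hne (by rw [hij])
  rw [hij] at this
  exact units_ne_neg _ this

theorem stepRev_ne_succ (h : IsMinimalCircuit ε w) (i : Fin n) : stepRev (w i) ≠ w (i + 1) := by
  intro hc
  have := h.arrow_eq i
  rw [hc] at this
  exact units_ne_neg _ this

/-- The reversed step starts where step `i` ends, so `j` is `i + 1` or its twin; the arrow condition
forbids turning straight back at `i + 1`. -/
theorem eq_next_of_eq_stepRev (h : IsMinimalCircuit ε w) {i j : Fin n} (hj : w j = stepRev (w i)) :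
    j = h.next i := by
  have hv : G.source (w j) = G.source (w (i + 1)) := by
    rw [hj, source_stepRev, h.target_eq]
  rcases h.eq_or_eq_twin hv with rfl | h1
  · exact absurd hj.symm (h.stepRev_ne_succ i)
  · exact h1

theorem eq_or_eq_next (h : IsMinimalCircuit ε w) {i j : Fin n} (he : (w j).1 = (w i).1) :
    j = i ∨ j = h.next i ∧ w j = stepRev (w i) := by
  rcases eq_or_eq_stepRev he with h1 | h1
  · exact Or.inl (h.injective h1)
  · exact Or.inr ⟨h.eq_next_of_eq_stepRev h1, h1⟩

/-- The region of the position `i` consists of a single edge that is traversed twice. -/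
def IsDouble (h : IsMinimalCircuit ε w) (i : Fin n) : Prop := w (h.next i) = stepRev (w i)

theorem IsDouble.next_next {h : IsMinimalCircuit ε w} {i : Fin n} (hi : h.IsDouble i) :
    h.next (h.next i) = i := by
  refine (h.eq_next_of_eq_stepRev ?_).symm
  rw [hi, stepRev_stepRev]

theorem IsDouble.next {h : IsMinimalCircuit ε w} {i : Fin n} (hi : h.IsDouble i) :
    h.IsDouble (h.next i) := by
  unfold IsDouble
  rw [hi.next_next, hi, stepRev_stepRev]

theorem isDouble_next_iff (h : IsMinimalCircuit ε w) {i : Fin n} :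
    h.IsDouble (h.next i) ↔ h.IsDouble i := by
  refine ⟨fun hi => ?_, IsDouble.next⟩
  have h1 := hi.next
  have h2 := hi.next_next
  have : h.next (h.next i) = i := h.next.injective h2
  rwa [this] at h1

theorem IsDouble.next_ne {h : IsMinimalCircuit ε w} {i : Fin n} (hi : h.IsDouble i) :
    h.next i ≠ i := by
  intro hc
  unfold IsDouble at hi
  rw [hc] at hi
  exact stepRev_ne _ hi.symm

theorem IsDouble.twin_succ_ne {h : IsMinimalCircuit ε w} {i : Fin n} (hi : h.IsDouble i) :
    twin G w (i + 1) ≠ i + 1 := by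
  intro hc
  refine h.stepRev_ne_succ i ?_
  rw [← hi, next_apply, hc]

theorem IsDouble.twin_eq {h : IsMinimalCircuit ε w} {i : Fin n} (hi : h.IsDouble i) :
    twin G w i = twin G w (i + 1) + 1 := by
  have := hi.next_next
  rw [next_apply, next_apply] at this
  rw [← h.twin_twin (twin G w (i + 1) + 1), this]

theorem IsDouble.twin_ne {h : IsMinimalCircuit ε w} {i : Fin n} (hi : h.IsDouble i) :
    twin G w i ≠ i := by
  have := hi.next.twin_succ_ne
  rw [next_apply, ← hi.twin_eq, h.twin_twin] at this
  exact this.symm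

theorem eq_of_fst_eq_of_not_isDouble (h : IsMinimalCircuit ε w) {i j : Fin n}
    (hi : ¬ h.IsDouble i) (he : (w j).1 = (w i).1) : j = i := by
  rcases h.eq_or_eq_next he with h1 | ⟨h1, h2⟩
  · exact h1
  · rw [h1] at h2
    exact absurd h2 hi

theorem isDouble_iff_of_fst_eq (h : IsMinimalCircuit ε w) {i j : Fin n}
    (he : (w j).1 = (w i).1) : h.IsDouble j ↔ h.IsDouble i := by
  rcases h.eq_or_eq_next he with rfl | ⟨h1, -⟩
  · rfl
  · rw [h1, isDouble_next_iff]

theorem sameCycle_invariant (h : IsMinimalCircuit ε w) {P : Fin n → Prop}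
    (hP : ∀ k, P k → P (h.next k)) {a b : Fin n} (hab : h.next.SameCycle a b) (ha : P a) : P b := by
  obtain ⟨m, -, rfl⟩ := hab.exists_pow_eq'
  clear hab
  induction m with
  | zero => simpa using ha
  | succ m ih =>
    rw [pow_succ', Equiv.Perm.mul_apply]
    exact hP _ ih

theorem isDouble_iff_of_sameCycle (h : IsMinimalCircuit ε w) {a b : Fin n}
    (hab : h.next.SameCycle a b) : h.IsDouble a ↔ h.IsDouble b :=
  ⟨h.sameCycle_invariant (fun _ hk => hk.next) hab,
    h.sameCycle_invariant (fun _ hk => hk.next) hab.symm⟩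

theorem sameCycle_next (h : IsMinimalCircuit ε w) (a : Fin n) : h.next.SameCycle a (h.next a) :=
  ⟨1, by simp⟩

section Sides

/-! Two positions `i < j` of the same vertex split the circuit into `[i, j)` and the rest. -/

variable {i j : Fin n}

/-- A region cannot leave one side of a chord: passing to `k + 1` meets the far end `j` only to jump
back to `i`, and any other jump outside would cross the chord. -/
theorem mem_Ico_next (h : IsMinimalCircuit ε w) (hij : i < j)
    (hv : G.source (w i) = G.source (w j)) {k : Fin n} (hk : k ∈ Set.Ico i j) :
    h.next k ∈ Set.Ico i j := by
  have hk1 : (k + 1).val = k.val + 1 := by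
    rcases fin_val_succ k with h1 | h1
    · exact h1.2
    · have := j.isLt
      simp only [Set.mem_Ico, Fin.le_def, Fin.lt_def] at hk
      omega
  have htj : twin G w j = i :=
    ((h.eq_or_eq_twin hv).resolve_left hij.ne).symm
  have hti : twin G w i = j := by rw [← htj, h.twin_twin]
  rw [next_apply]
  by_cases hkj : k + 1 = j
  · rw [hkj, htj]
    simp [hij]
  · have hlt : k + 1 < j := by
      have := Fin.val_ne_of_ne hkj
      simp only [Set.mem_Ico, Fin.le_def, Fin.lt_def] at *
      omega
    have hgt : i < k + 1 := by
      simp only [Set.mem_Ico, Fin.le_def, Fin.lt_def] at *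
      omega
    have hs := source_twin G w (k + 1)
    refine ⟨not_lt.mp fun hc => ?_, not_le.mp fun hc => ?_⟩
    · exact h.noncrossing hc hgt hlt hs hv
    · rcases hc.eq_or_lt with hc | hc
      · rw [hc] at hti
        exact hgt.ne (h.twin_involutive.injective hti)
      · exact h.noncrossing hgt hlt hc hv hs.symm

theorem mem_Ico_of_sameCycle (h : IsMinimalCircuit ε w) (hij : i < j)
    (hv : G.source (w i) = G.source (w j)) {a b : Fin n} (hab : h.next.SameCycle a b) :
    a ∈ Set.Ico i j ↔ b ∈ Set.Ico i j :=
  ⟨h.sameCycle_invariant (fun _ hk => h.mem_Ico_next hij hv hk) hab,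
    h.sameCycle_invariant (fun _ hk => h.mem_Ico_next hij hv hk) hab.symm⟩

theorem mem_Ico_succ (hij : i < j) {k : Fin n} (h1 : k + 1 ≠ i) (h2 : k + 1 ≠ j) :
    k + 1 ∈ Set.Ico i j ↔ k ∈ Set.Ico i j := by
  have h1 := Fin.val_ne_of_ne h1
  have h2 := Fin.val_ne_of_ne h2
  have := i.isLt
  have := j.isLt
  simp only [Set.mem_Ico, Fin.le_def, Fin.lt_def] at *
  rcases fin_val_succ k with h3 | h3 <;> omega

theorem mem_Ico_succ_not (hij : i < j) {k : Fin n} (h1 : k + 1 = i ∨ k + 1 = j) :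
    k + 1 ∈ Set.Ico i j ↔ k ∉ Set.Ico i j := by
  have := i.isLt
  have := j.isLt
  have h1 : (k + 1).val = i.val ∨ (k + 1).val = j.val := h1.imp (congrArg _) (congrArg _)
  simp only [Set.mem_Ico, Fin.le_def, Fin.lt_def] at *
  rcases fin_val_succ k with h3 | h3 <;> omega

theorem mem_Ico_twin (h : IsMinimalCircuit ε w) (hij : i < j)
    (hv : G.source (w i) = G.source (w j)) {p : Fin n} (h1 : p ≠ i) (h2 : p ≠ j) :
    twin G w p ∈ Set.Ico i j ↔ p ∈ Set.Ico i j := by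
  have h3 := h.mem_Ico_of_sameCycle hij hv (h.sameCycle_next (p - 1))
  rw [next_sub_one] at h3
  rw [← h3]
  have := mem_Ico_succ hij (k := p - 1) (by simpa using h1) (by simpa using h2)
  rw [sub_add_cancel] at this
  exact this.symm

/-- Only the vertex of the chord is shared by both sides: all visits to any other vertex lie on one
side, together with the edges that end there. -/
theorem mem_Ico_of_common_end (h : IsMinimalCircuit ε w) (hij : i < j)
    (hv : G.source (w i) = G.source (w j)) {k k' : Fin n} {x : V} (hx : x ≠ G.source (w i))
    (h1 : G.IsEnd x (w k).1) (h2 : G.IsEnd x (w k').1) :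
    k ∈ Set.Ico i j ↔ k' ∈ Set.Ico i j := by
  have key : ∀ k : Fin n, G.IsEnd x (w k).1 →
      ∃ p, G.source (w p) = x ∧ (p ∈ Set.Ico i j ↔ k ∈ Set.Ico i j) := by
    intro k hk
    rcases (isEnd_iff _).mp hk with hk | hk
    · exact ⟨k, hk, Iff.rfl⟩
    · rw [h.target_eq] at hk
      refine ⟨k + 1, hk, mem_Ico_succ hij ?_ ?_⟩
      · rintro h3
        rw [h3] at hk
        exact hx hk.symm
      · rintro h3
        rw [h3, ← hv] at hk
        exact hx hk.symm
  obtain ⟨p, hp, hpk⟩ := key k h1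
  obtain ⟨p', hp', hpk'⟩ := key k' h2
  rw [← hpk, ← hpk']
  rcases h.eq_or_eq_twin (hp.trans hp'.symm) with rfl | rfl
  · rfl
  · refine h.mem_Ico_twin hij hv ?_ ?_
    · rintro rfl
      exact hx hp'.symm
    · rintro rfl
      exact hx (hp'.symm.trans hv.symm)

theorem mem_Ico_of_fst_eq (h : IsMinimalCircuit ε w) (hij : i < j)
    (hv : G.source (w i) = G.source (w j)) {k k' : Fin n} (he : (w k).1 = (w k').1) :
    k ∈ Set.Ico i j ↔ k' ∈ Set.Ico i j := by
  rcases h.eq_or_eq_next he with rfl | ⟨rfl, -⟩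
  · rfl
  · exact (h.mem_Ico_of_sameCycle hij hv (h.sameCycle_next k')).symm

end Sides

/-- Otherwise the chord joining `a` and `b` would separate them, although regions respect sides. -/
theorem eq_of_sameCycle (h : IsMinimalCircuit ε w) {a b : Fin n} (hab : h.next.SameCycle a b)
    (hv : G.source (w a) = G.source (w b)) : a = b := by
  by_contra hne
  wlog hlt : a < b generalizing a b
  · exact this hab.symm hv.symm (Ne.symm hne) (lt_of_le_of_ne (not_lt.mp hlt) (Ne.symm hne))
  have := (h.mem_Ico_of_sameCycle hlt hv hab).mp ⟨le_rfl, hlt⟩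
  exact lt_irrefl _ this.2

end IsMinimalCircuit

end MinimalCircuits


/-! ### The regions as the cycles of the graph, cut-points and parity. -/

section CyclicWalks

variable {V E : Type*}

theorem isChain_cyclic {α : Type*} {R : α → α → Prop} {W : List α} [NeZero W.length]
    (hW : W.IsChain R) (hne : W ≠ []) (hlast : R (W.getLast hne) (W.head hne))
    (t : Fin W.length) : R (W.get t) (W.get (t + 1)) := by
  rw [List.isChain_iff_getElem] at hW
  rcases fin_val_succ t with ⟨h1, h2⟩ | ⟨h1, h2⟩
  · have := hW t.val h1
    simpa [h2] using this
  · have h3 : W.getLast hne = W.get t := by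
      rw [List.getLast_eq_getElem]
      simp [← h1]
    have h4 : W.head hne = W.get (t + 1) := by
      rw [List.head_eq_getElem]
      simp [h2]
    rwa [h3, h4] at hlast

theorem neZero_length {α : Type*} {W : List α} (hne : W ≠ []) : NeZero W.length :=
  ⟨fun h => hne (List.length_eq_zero_iff.mp h)⟩

theorem IsCycle.exists_cyclic [DecidableEq E] {G : SignedGraph V E} {C : Finset E}
    (hC : G.IsCycle C) : ∃ (m : ℕ) (_ : NeZero m) (d : Fin m → E × Bool),
      (∀ t, G.target (d t) = G.source (d (t + 1))) ∧
      Function.Injective (fun t => G.source (d t)) ∧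
      Function.Injective (fun t => (d t).1) ∧ ∀ e, e ∈ C ↔ ∃ t, (d t).1 = e := by
  obtain ⟨W, ⟨hW, hne, hcl⟩, hs, he, rfl⟩ := hC
  have := neZero_length hne
  refine ⟨W.length, inferInstance, W.get, isChain_cyclic hW hne hcl.symm, ?_, ?_, ?_⟩
  · intro a b hab
    have := (List.nodup_iff_injective_get.mp hs)
    have h2 := @this (a.cast (by simp)) (b.cast (by simp)) (by simpa using hab)
    simpa [Fin.ext_iff] using h2
  · intro a b hab
    have := (List.nodup_iff_injective_get.mp he)
    have h2 := @this (a.cast (by simp)) (b.cast (by simp)) (by simpa using hab)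
    simpa [Fin.ext_iff] using h2
  · intro e
    rw [walkSupport, List.mem_toFinset, List.mem_map]
    constructor
    · rintro ⟨d, hd, rfl⟩
      obtain ⟨t, rfl⟩ := List.mem_iff_get.mp hd
      exact ⟨t, rfl⟩
    · rintro ⟨t, rfl⟩
      exact ⟨_, List.get_mem W t, rfl⟩

namespace IsMinimalCircuit

variable [Fintype E] [DecidableEq V] [DecidableEq E] {G : SignedGraph V E}
  {ε : G.Orientation} {n : ℕ} [NeZero n] {w : Fin n → E × Bool}

open Classical in
/-- The edges of the region of the position `k`. -/
noncomputable def region (h : IsMinimalCircuit ε w) (k : Fin n) : Finset E :=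
  (Finset.univ.filter fun i => h.next.SameCycle k i).image fun i => (w i).1

theorem mem_region (h : IsMinimalCircuit ε w) {k : Fin n} {e : E} :
    e ∈ h.region k ↔ ∃ i, h.next.SameCycle k i ∧ (w i).1 = e := by
  simp [region]

theorem mem_region_self (h : IsMinimalCircuit ε w) (k : Fin n) : (w k).1 ∈ h.region k :=
  h.mem_region.mpr ⟨k, Equiv.Perm.SameCycle.refl _ _, rfl⟩

theorem region_eq_of_sameCycle (h : IsMinimalCircuit ε w) {k l : Fin n}
    (hkl : h.next.SameCycle k l) : h.region k = h.region l := by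
  ext e
  rw [mem_region, mem_region]
  exact ⟨fun ⟨i, hi, he⟩ => ⟨i, hkl.symm.trans hi, he⟩, fun ⟨i, hi, he⟩ => ⟨i, hkl.trans hi, he⟩⟩

theorem sameCycle_of_mem_region (h : IsMinimalCircuit ε w) {k l : Fin n} (hl : ¬ h.IsDouble l)
    (hm : (w l).1 ∈ h.region k) : h.next.SameCycle k l := by
  obtain ⟨i, hi, he⟩ := h.mem_region.mp hm
  rwa [h.eq_of_fst_eq_of_not_isDouble hl he] at hi

theorem mem_verts_region (h : IsMinimalCircuit ε w) {k : Fin n} {x : V} :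
    x ∈ G.verts (h.region k) ↔ ∃ i, h.next.SameCycle k i ∧ G.source (w i) = x := by
  constructor
  · rintro ⟨e, he, hx⟩
    obtain ⟨i, hi, rfl⟩ := h.mem_region.mp he
    rcases (isEnd_iff _).mp hx with hx | hx
    · exact ⟨i, hi, hx⟩
    · exact ⟨h.next i, hi.trans (h.sameCycle_next i), by rw [source_next, hx]⟩
  · rintro ⟨i, hi, hx⟩
    exact ⟨_, h.mem_region.mpr ⟨i, hi, rfl⟩, (isEnd_iff _).mpr (Or.inl hx)⟩

/-- The orbit of `k` under `next`, read through one period, is a closed walk. Its vertices are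
distinct by `eq_of_sameCycle`, its edges because none of them is doubled. -/
theorem isCycle_region (h : IsMinimalCircuit ε w) {k : Fin n} (hk : ¬ h.IsDouble k) :
    G.IsCycle (h.region k) := by
  set m := Function.minimalPeriod h.next k with hm
  have hm0 : 0 < m := Function.minimalPeriod_pos_of_mem_periodicPts
    (Function.mem_periodicPts.mpr ⟨orderOf h.next, orderOf_pos _, by
      rw [Function.IsPeriodicPt, Function.IsFixedPt, Equiv.Perm.iterate_eq_pow, pow_orderOf_eq_one,
        Equiv.Perm.one_apply]⟩)
  have hsame : ∀ t : ℕ, h.next.SameCycle k (h.next^[t] k) := fun t =>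
    ⟨t, by rw [zpow_natCast, Equiv.Perm.iterate_eq_pow]⟩
  have hinj : ∀ a ∈ List.range m, ∀ b ∈ List.range m, h.next^[a] k = h.next^[b] k → a = b := by
    intro a ha b hb hab
    exact Function.iterate_injOn_Iio_minimalPeriod (List.mem_range.mp ha) (List.mem_range.mp hb) hab
  refine ⟨(List.range m).map fun t => w (h.next^[t] k), ⟨?_, ?_, ?_⟩, ?_, ?_, ?_⟩
  · rw [IsWalk, List.isChain_iff_getElem]
    intro t ht
    simp only [List.getElem_map, List.getElem_range]
    rw [Function.iterate_succ_apply', source_next]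
  · simp [hm0.ne']
  · rw [List.head_eq_getElem, List.getLast_eq_getElem]
    simp only [List.getElem_map, List.getElem_range, List.length_map, List.length_range]
    rw [← h.source_next, ← Function.iterate_succ_apply' h.next,
      show (m - 1).succ = m by omega, hm, Function.iterate_minimalPeriod]
    rfl
  · rw [List.map_map]
    refine List.Nodup.map_on (fun a ha b hb hab => hinj a ha b hb ?_) List.nodup_range
    exact h.eq_of_sameCycle ((hsame a).symm.trans (hsame b)) hab
  · rw [List.map_map]
    refine List.Nodup.map_on (fun a ha b hb hab => hinj a ha b hb ?_) List.nodup_range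
    exact h.eq_of_fst_eq_of_not_isDouble
      (fun hc => hk ((h.isDouble_iff_of_sameCycle (hsame b)).mpr hc)) hab
  · ext e
    rw [walkSupport, List.mem_toFinset, List.map_map, List.mem_map, mem_region]
    constructor
    · rintro ⟨t, -, rfl⟩
      exact ⟨_, hsame t, rfl⟩
    · rintro ⟨i, hi, rfl⟩
      obtain ⟨t, -, rfl⟩ := hi.exists_pow_eq'
      refine ⟨t % m, List.mem_range.mpr (Nat.mod_lt _ hm0), ?_⟩
      simp only [Function.comp]
      rw [hm, Function.iterate_mod_minimalPeriod_eq, Equiv.Perm.iterate_eq_pow]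

/-! ### Every cycle in the support is a region. -/

section Cycles

variable {m : ℕ} [NeZero m] {d : Fin m → E × Bool}

/-- Starting from its only visit to the vertex of the chord, the cycle goes round through other
vertices, where it cannot change sides. -/
theorem cycle_mem_Ico (h : IsMinimalCircuit ε w) (hd : ∀ t, G.target (d t) = G.source (d (t + 1)))
    (hs : Function.Injective fun t => G.source (d t)) (hr : ∀ t, ∃ k, (w k).1 = (d t).1)
    {i j : Fin n} (hij : i < j) (hv : G.source (w i) = G.source (w j)) {t : Fin m}
    (ht : G.source (d t) = G.source (w i)) {k k' : Fin n} {s : Fin m} (hk : (w k).1 = (d t).1)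
    (hk' : (w k').1 = (d s).1) : k ∈ Set.Ico i j ↔ k' ∈ Set.Ico i j := by
  obtain ⟨s, hs', rfl⟩ : ∃ a : ℕ, a < m ∧ s = t + a := ⟨(s - t).val, (s - t).isLt, by simp⟩
  induction s generalizing k' with
  | zero => exact h.mem_Ico_of_fst_eq hij hv (by rw [hk, hk']; simp)
  | succ s ih =>
    obtain ⟨l, hl⟩ := hr (t + s)
    rw [ih (by omega) hl]
    have e1 : t + ((s + 1 : ℕ) : Fin m) = t + s + 1 := by push_cast; ring
    rw [e1] at hk'
    refine h.mem_Ico_of_common_end hij hv (x := G.source (d (t + s + 1))) ?_ ?_ ?_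
    -- Since `s + 1 < m`, the cycle has not yet returned to `t`, so this vertex is not that of the
    -- chord.
    · rw [← ht, ← e1]
      intro hc
      have := hs hc
      rw [add_eq_left] at this
      have := congrArg Fin.val this
      rw [Fin.val_natCast, Nat.mod_eq_of_lt hs'] at this
      simp at this
    · rw [hl, isEnd_iff, hd]
      exact Or.inr rfl
    · rw [hk', isEnd_iff]
      exact Or.inl rfl

/-- At a vertex with a chord, four ends of steps are available. All but the one given by `next` lie
across the chord or retrace the edge just used. -/
theorem cycle_succ (h : IsMinimalCircuit ε w) (hd : ∀ t, G.target (d t) = G.source (d (t + 1)))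
    (hs : Function.Injective fun t => G.source (d t)) (he : Function.Injective fun t => (d t).1)
    (hr : ∀ t, ∃ k, (w k).1 = (d t).1) {t : Fin m} {k : Fin n} (hk : d t = w k) :
    d (t + 1) = w (h.next k) := by
  have hsrc : G.source (d (t + 1)) = G.source (w (k + 1)) := by
    rw [← hd, hk, h.target_eq]
  have side : ∀ {i j : Fin n}, i < j → G.source (w i) = G.source (w j) →
      G.source (w i) = G.source (w (k + 1)) → ∀ {l}, (w l).1 = (d (t + 1)).1 →
      (k ∈ Set.Ico i j ↔ l ∈ Set.Ico i j) := by
    intro i j hij hv hi l hl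
    exact (h.cycle_mem_Ico hd hs hr hij hv (hsrc.trans hi.symm) hl (by rw [hk])).symm
  obtain ⟨l, hl⟩ := hr (t + 1)
  rw [next_apply]
  rcases eq_or_eq_stepRev hl.symm with h1 | h1
  · have hl' : G.source (w l) = G.source (w (k + 1)) := by rw [← hsrc, h1]
    rcases h.eq_or_eq_twin hl' with h2 | h2
    · by_cases ht : twin G w (k + 1) = k + 1
      · rw [ht, h1, h2]
      · exfalso
        obtain ⟨i, j, hij, hv, hi, hor⟩ := exists_chord ht
        have h3 := side hij hv hi hl
        rw [h2, mem_Ico_succ_not hij (hor.imp (fun a => a.1.symm) (fun a => a.2.symm))] at h3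
        tauto
    · rw [h1, h2]
  · exfalso
    have hl' : G.source (w (l + 1)) = G.source (w (k + 1)) := by
      rw [← hsrc, h1, source_stepRev, h.target_eq]
    rcases h.eq_or_eq_twin hl' with h2 | h2
    · have h3 : l = k := add_right_cancel h2
      have h4 : t + 1 = t := he (by simp only; rw [← hl, hk, h3])
      rw [h4, hk, h3] at h1
      exact stepRev_ne _ h1.symm
    · by_cases ht : twin G w (k + 1) = k + 1
      · rw [ht] at h2
        have h3 : l = k := add_right_cancel h2
        have h4 : t + 1 = t := he (by simp only; rw [← hl, hk, h3])
        rw [h4, hk, h3] at h1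
        exact stepRev_ne _ h1.symm
      · obtain ⟨i, j, hij, hv, hi, hor⟩ := exists_chord ht
        have h3 := side hij hv hi hl
        -- Here `next l = k + 1`, so `l` is on the side of `k + 1`, which is opposite to that of
        -- `k`.
        have h4 := h.mem_Ico_of_sameCycle hij hv (h.sameCycle_next l)
        rw [next_apply, h2, h.twin_twin] at h4
        rw [h4, mem_Ico_succ_not hij (hor.imp (fun a => a.1.symm) (fun a => a.2.symm))] at h3
        tauto

theorem cycle_eq_region_aux (h : IsMinimalCircuit ε w)
    (hd : ∀ t, G.target (d t) = G.source (d (t + 1)))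
    (hs : Function.Injective fun t => G.source (d t)) (he : Function.Injective fun t => (d t).1)
    (hr : ∀ t, ∃ k, (w k).1 = (d t).1) {t : Fin m} {k : Fin n} (hk : d t = w k) :
    ¬ h.IsDouble k ∧ ∀ e, e ∈ h.region k ↔ ∃ s, (d s).1 = e := by
  refine ⟨fun hc => ?_, fun e => ?_⟩
  · have h1 := h.cycle_succ hd hs he hr hk
    rw [hc, ← hk] at h1
    have h2 : t + 1 = t := he (by simp only; rw [h1, stepRev_fst])
    rw [h2] at h1
    exact stepRev_ne _ h1.symm
  · have key : ∀ a : ℕ, d (t + a) = w ((h.next ^ a) k) := by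
      intro a
      induction a with
      | zero => simpa using hk
      | succ a ih =>
        have e1 : t + ((a + 1 : ℕ) : Fin m) = t + a + 1 := by push_cast; ring
        rw [e1, h.cycle_succ hd hs he hr ih, pow_succ', Equiv.Perm.mul_apply]
    rw [mem_region]
    constructor
    · rintro ⟨i, hi, rfl⟩
      obtain ⟨a, -, rfl⟩ := hi.exists_pow_eq'
      exact ⟨t + a, by rw [key]⟩
    · rintro ⟨s, rfl⟩
      refine ⟨(h.next ^ (s - t).val) k, ⟨((s - t).val : ℕ), by simp⟩, ?_⟩
      rw [← key]
      simp

theorem cycle_eq_region (h : IsMinimalCircuit ε w) {C : Finset E} (hC : G.IsCycle C)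
    (hr : ∀ e ∈ C, ∃ k, (w k).1 = e) : ∃ k, ¬ h.IsDouble k ∧ C = h.region k := by
  obtain ⟨m, _, d, hd, hs, he, hm⟩ := hC.exists_cyclic
  have hr' : ∀ t, ∃ k, (w k).1 = (d t).1 := fun t => hr _ ((hm _).mpr ⟨t, rfl⟩)
  obtain ⟨k, hk⟩ := hr' 0
  rcases eq_or_eq_stepRev hk.symm with h1 | h1
  · obtain ⟨h2, h3⟩ := h.cycle_eq_region_aux hd hs he hr' h1
    exact ⟨k, h2, Finset.ext fun e => by rw [hm, h3]⟩
  -- The cycle traverses this edge against the circuit, so it is replaced by its reverse.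
  · obtain ⟨h2, h3⟩ := h.cycle_eq_region_aux (d := fun t => stepRev (d (-t)))
      (t := 0) (k := k) (fun t => by
        rw [target_stepRev, source_stepRev, hd]
        congr 2
        ring)
      (fun a b hab => by
        simp only [source_stepRev, hd] at hab
        have := hs hab
        simpa using this)
      (fun a b hab => by
        have := he hab
        simpa using this)
      (fun t => hr' (-t)) (by simp [h1])
    refine ⟨k, h2, Finset.ext fun e => ?_⟩
    rw [hm, h3]
    constructor
    · rintro ⟨t, rfl⟩
      exact ⟨-t, by simp⟩
    · rintro ⟨t, rfl⟩
      exact ⟨-t, rfl⟩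

end Cycles

section RegionFamilies

/-- The chord at one common vertex separates the two regions, and no other vertex lies on both sides
of it. -/
theorem region_inter_subsingleton (h : IsMinimalCircuit ε w) {k l : Fin n}
    (hkl : ¬ h.next.SameCycle k l) :
    (G.verts (h.region k) ∩ G.verts (h.region l)).Subsingleton := by
  rintro x ⟨hx1, hx2⟩ y ⟨hy1, hy2⟩
  rw [mem_verts_region] at hx1 hx2 hy1 hy2
  obtain ⟨a, ha, rfl⟩ := hx1
  obtain ⟨b, hb, hab⟩ := hx2
  obtain ⟨p, hp, rfl⟩ := hy1
  obtain ⟨q, hq, hpq⟩ := hy2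
  by_contra hne
  have key : ∀ {a b p q : Fin n}, a < b → G.source (w b) = G.source (w a) →
      G.source (w q) = G.source (w p) → h.next.SameCycle a p → h.next.SameCycle b q →
      G.source (w a) ≠ G.source (w p) → False := by
    intro a b p q hlt hab hpq hap hbq hne
    have h1 := h.mem_Ico_of_sameCycle hlt hab.symm hap
    have h2 := h.mem_Ico_of_sameCycle hlt hab.symm hbq
    have h3 : p ∈ Set.Ico a b ↔ q ∈ Set.Ico a b := by
      rcases h.eq_or_eq_twin hpq with rfl | rfl
      · rfl
      · refine (h.mem_Ico_twin hlt hab.symm ?_ ?_).symm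
        · rintro rfl
          exact hne rfl
        · rintro rfl
          exact hne hab.symm
    have h4 := h1.mp ⟨le_rfl, hlt⟩
    exact lt_irrefl _ (h2.mpr (h3.mp h4)).2
  have hne' : a ≠ b := by
    rintro rfl
    exact hkl (ha.trans hb.symm)
  rcases lt_or_gt_of_ne hne' with hlt | hlt
  · exact key hlt hab hpq (ha.symm.trans hp) (hb.symm.trans hq) hne
  · exact key hlt hab.symm hpq.symm (hb.symm.trans hq) (ha.symm.trans hp)
      (by rwa [hab, hpq])

end RegionFamilies

section Connectivity

theorem linked_empty (h : IsMinimalCircuit ε w) {S : Finset E} (hS : ∀ i, (w i).1 ∈ S)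
    (i j : Fin n) : G.Linked S ∅ (w i).1 (w j).1 := by
  obtain ⟨s, rfl⟩ : ∃ a : ℕ, j = i + a := ⟨(j - i).val, by simp⟩
  induction s with
  | zero =>
    simp only [Nat.cast_zero, add_zero]
    exact Relation.ReflTransGen.refl
  | succ s ih =>
    have e1 : i + ((s + 1 : ℕ) : Fin n) = i + s + 1 := by push_cast; ring
    rw [e1]
    refine ih.tail ⟨hS _, hS _, G.source (w (i + s + 1)), Set.notMem_empty _, ?_, ?_⟩
    · rw [isEnd_iff, h.target_eq]
      exact Or.inr rfl
    · rw [isEnd_iff]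
      exact Or.inl rfl

/-- Once the vertex of the chord is removed, adjacent edges stay on one side, while positions `i`
and `j` are on different sides. -/
theorem isCutPoint (h : IsMinimalCircuit ε w) {S : Finset E} (hS : ∀ e, e ∈ S ↔ ∃ i, (w i).1 = e)
    {p : Fin n} (hp : twin G w p ≠ p) : G.IsCutPoint S (G.source (w p)) := by
  obtain ⟨i, j, hij, hv, hi, -⟩ := exists_chord hp
  have hS' : ∀ i, (w i).1 ∈ S := fun i => (hS _).mpr ⟨i, rfl⟩
  refine ⟨_, hS' i, _, hS' j, h.linked_empty hS' i j, fun hc => ?_⟩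
  have key : ∀ e, G.Linked S {G.source (w p)} (w i).1 e →
      ∀ k, (w k).1 = e → k ∈ Set.Ico i j := by
    intro e he
    induction he with
    | refl => exact fun k hk => (h.mem_Ico_of_fst_eq hij hv hk).mpr ⟨le_rfl, hij⟩
    | tail _ hstep ih =>
      obtain ⟨h1, h2, x, hx, h3, h4⟩ := hstep
      intro k hk
      obtain ⟨l, rfl⟩ := (hS _).mp h1
      subst hk
      exact (h.mem_Ico_of_common_end hij hv (by rw [hi]; exact hx) h3 h4).mp (ih l rfl)
  exact lt_irrefl _ (key _ hc j rfl).2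

end Connectivity

section Parity

open Classical in
-- The sign of edge `i` is the product of the arrows at `i` and `i + 1`. Replacing `i + 1` by its
-- twin `next i` costs `-1` exactly when a chord is crossed; around the region each arrow then
-- occurs twice.
theorem prod_sign_region (h : IsMinimalCircuit ε w) {k : Fin n} (hk : ¬ h.IsDouble k) :
    ∏ e ∈ h.region k, G.sign e =
      (-1) ^ (Finset.univ.filter fun i => h.next.SameCycle k i ∧ twin G w i ≠ i).card := by
  have hinj : Set.InjOn (fun i => (w i).1)
      (Finset.univ.filter fun i => h.next.SameCycle k i : Finset (Fin n)) := by
    intro a ha b hb hab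
    simp only [Finset.mem_coe, Finset.mem_filter, Finset.mem_univ, true_and] at ha hb
    exact h.eq_of_fst_eq_of_not_isDouble
      (fun hc => hk ((h.isDouble_iff_of_sameCycle hb).mpr hc)) hab
  rw [region, Finset.prod_image hinj]
  have h1 : ∀ i, G.sign (w i).1 = ε.arrow (w i) * (ε.arrow (w (h.next i)) *
      if twin G w (h.next i) ≠ h.next i then -1 else 1) := by
    intro i
    have h2 := arrow_mul_arrow_stepRev ε (w i)
    rw [h.arrow_eq] at h2
    have h3 : ε.arrow (w (i + 1)) = ε.arrow (w (h.next i)) *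
        if twin G w (h.next i) ≠ h.next i then -1 else 1 := by
      rw [next_apply]
      split_ifs with h4
      · rw [h.twin_twin] at h4
        rw [h.arrow_ne h4 (source_twin G w _).symm, mul_neg, mul_one]
      · rw [h.twin_twin, not_not] at h4
        rw [← h4, mul_one]
    rw [← h3, ← neg_inj, ← h2, mul_neg]
  have h5 : ∀ F : Fin n → ℤˣ,
      ∏ i ∈ Finset.univ.filter (fun i => h.next.SameCycle k i), F (h.next i) =
      ∏ i ∈ Finset.univ.filter (fun i => h.next.SameCycle k i), F i := by
    intro F
    refine Finset.prod_equiv h.next (fun i => ?_) (fun _ _ => rfl)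
    simp
  rw [Finset.prod_congr rfl fun i _ => h1 i, Finset.prod_mul_distrib,
    h5 (fun i => ε.arrow (w i) * if twin G w i ≠ i then -1 else 1), Finset.prod_mul_distrib,
    ← mul_assoc, ← Finset.prod_mul_distrib, Finset.prod_congr rfl fun i _ => Int.units_mul_self _,
    Finset.prod_const_one, one_mul, ← Finset.prod_filter, Finset.prod_const, Finset.filter_filter]

end Parity

end IsMinimalCircuit

end CyclicWalks


/-! ### Block paths as maximal runs of doubled edges. -/

section BlockPaths

variable {V E : Type*}

/-- The path along a run. -/
def runPath (G : SignedGraph V E) {n : ℕ} [NeZero n] (w : Fin n → E × Bool) (i : Fin n) (k : ℕ) : PathData V E :=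
  ⟨G.source (w i), (List.range k).map fun s : ℕ => w (i + (s : Fin n))⟩

theorem mem_steps_runPath {G : SignedGraph V E} {n : ℕ} [NeZero n] {w : Fin n → E × Bool} {i : Fin n} {k : ℕ} {e : E} :
    e ∈ (runPath G w i k).steps.map Prod.fst ↔ ∃ s : ℕ, s < k ∧ (w (i + s)).1 = e := by
  simp [runPath]

theorem mem_image_fst [DecidableEq E] {n : ℕ} {w : Fin n → E × Bool} {e : E} : e ∈ Finset.univ.image (fun i => (w i).1) ↔ ∃ i, (w i).1 = e := by
  simp

namespace IsMinimalCircuit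

variable [Fintype E] [DecidableEq V] [DecidableEq E] {G : SignedGraph V E}
  {ε : G.Orientation} {n : ℕ} [NeZero n] {w : Fin n → E × Bool}

/-- A maximal run of `k` positions of double edges, starting at the position `i`. -/
structure IsRun (h : IsMinimalCircuit ε w) (i : Fin n) (k : ℕ) : Prop where
  double : ∀ s : ℕ, s < k → h.IsDouble (i + s)
  twin_ne : twin G w i ≠ i
  before : ¬ h.IsDouble (i - 1)
  after : ¬ h.IsDouble (i + k)

/-- The circuit comes back along a run in the opposite order, so twins move backwards as positions
move forwards. -/
theorem twin_add_of_isDouble (h : IsMinimalCircuit ε w) {i : Fin n} {k : ℕ}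
    (hd : ∀ s : ℕ, s < k → h.IsDouble (i + s)) {s : ℕ} (hs : s ≤ k) :
    twin G w (i + s) = twin G w i - s := by
  induction s with
  | zero => simp
  | succ s ih =>
    have h1 := (hd s (by omega)).twin_eq
    rw [ih (by omega)] at h1
    have e1 : i + ((s + 1 : ℕ) : Fin n) = i + s + 1 := by push_cast; ring
    rw [e1, eq_sub_iff_add_eq]
    push_cast
    rw [sub_eq_iff_eq_add] at h1
    rw [h1]
    ring

/-- A run of double edges does not fold back onto itself. -/
theorem not_fold (h : IsMinimalCircuit ε w) {i : Fin n} {k : ℕ}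
    (hd : ∀ s : ℕ, s < k → h.IsDouble (i + s)) (hi : twin G w i ≠ i) : twin G w i ≠ i + k := by
  intro hc
  -- A fold has a midpoint: a position that is its own twin for even `k`, an edge whose two
  -- traversals coincide for odd `k`.
  obtain ⟨r, hr | hr⟩ := Nat.even_or_odd' k
  · have h1 := h.twin_add_of_isDouble hd (s := r) (by omega)
    rw [hc, hr] at h1
    have h2 : twin G w (i + r) = i + r := by
      rw [h1]
      push_cast
      ring
    rcases Nat.eq_zero_or_pos r with h0 | h0
    · rw [h0] at h2
      simp only [Nat.cast_zero, add_zero] at h2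
      exact hi h2
    · exact (hd r (by omega)).twin_ne h2
  · have h1 := h.twin_add_of_isDouble hd (s := r + 1) (by omega)
    rw [hc, hr] at h1
    have h2 : h.next (i + r) = i + r := by
      rw [next_apply]
      have e1 : i + ((r + 1 : ℕ) : Fin n) = i + r + 1 := by push_cast; ring
      rw [← e1, h1]
      push_cast
      ring
    exact (hd r (by omega)).next_ne h2

namespace IsRun

variable {h : IsMinimalCircuit ε w} {i : Fin n} {k : ℕ}

theorem twin_add (hr : h.IsRun i k) {s : ℕ} (hs : s ≤ k) : twin G w (i + s) = twin G w i - s :=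
  h.twin_add_of_isDouble hr.double hs

theorem isDouble_twin (hr : h.IsRun i k) {s : ℕ} (h0 : 0 < s) (hs : s ≤ k) :
    h.IsDouble (twin G w (i + s)) := by
  obtain ⟨s, rfl⟩ := Nat.exists_eq_succ_of_ne_zero h0.ne'
  have e1 : i + ((s.succ : ℕ) : Fin n) = i + s + 1 := by push_cast; ring
  rw [e1, ← next_apply (h := h), isDouble_next_iff]
  exact hr.double s (by omega)

theorem not_isDouble_twin (hr : h.IsRun i k) : ¬ h.IsDouble (twin G w i) := by
  rw [← h.next_sub_one, isDouble_next_iff]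
  exact hr.before

theorem reverse (hr : h.IsRun i k) : h.IsRun (twin G w (i + k)) k where
  double s hs := by
    have h1 := hr.isDouble_twin (s := k - s) (by omega) (by omega)
    rw [hr.twin_add (by omega), Nat.cast_sub hs.le] at h1
    rw [hr.twin_add le_rfl]
    convert h1 using 1
    ring
  twin_ne := by
    rw [h.twin_ne_self_iff]
    rcases Nat.eq_zero_or_pos k with rfl | hk
    · simpa using hr.twin_ne
    · obtain ⟨s, rfl⟩ := Nat.exists_eq_succ_of_ne_zero hk.ne'
      have e1 : i + ((s.succ : ℕ) : Fin n) = i + s + 1 := by push_cast; ring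
      rw [e1]
      exact (hr.double s (by omega)).twin_succ_ne
  before := by
    rw [← isDouble_next_iff, next_sub_one, h.twin_twin]
    exact hr.after
  after := by
    rw [hr.twin_add le_rfl, sub_add_cancel]
    exact hr.not_isDouble_twin

/-- By maximality, a later start would be preceded by a doubled position of the other run. The
offset `k` is allowed since a run of `k` edges has `k + 1` vertices. -/
theorem eq_of_add_eq (hr : h.IsRun i k) {i' : Fin n} {k' s s' : ℕ} (hr' : h.IsRun i' k')
    (hs : s ≤ k) (hs' : s' ≤ k') (he : i + s = i' + s') : i = i' ∧ k = k' ∧ s = s' := by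
  have key : ∀ {i i' : Fin n} {k k' s s' : ℕ}, h.IsRun i k → h.IsRun i' k' → s ≤ k → s' ≤ k' →
      i + s = i' + s' → ¬ s < s' := by
    intro i i' k k' s s' hr hr' hs hs' he hlt
    refine hr.before ?_
    have h1 := hr'.double (s' - s - 1) (by omega)
    rw [Nat.cast_sub (by omega), Nat.cast_sub (by omega)] at h1
    convert h1 using 1
    rw [← sub_eq_iff_eq_add] at he
    rw [eq_sub_of_add_eq (sub_eq_iff_eq_add.mp he)]
    push_cast
    ring
  have hss : s = s' := by
    have h1 := key hr hr' hs hs' he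
    have h2 := key hr' hr hs' hs he.symm
    omega
  subst hss
  have hii : i = i' := add_right_cancel he
  subst hii
  refine ⟨rfl, ?_, rfl⟩
  have h1 : ¬ k < k' := fun hlt => hr.after (hr'.double k hlt)
  have h2 : ¬ k' < k := fun hlt => hr'.after (hr.double k' hlt)
  omega

theorem eq_or_eq_reverse (hr : h.IsRun i k) {i' : Fin n} {k' s s' : ℕ} (hr' : h.IsRun i' k')
    (hs : s ≤ k) (hs' : s' ≤ k') (hv : G.source (w (i' + s')) = G.source (w (i + s))) :
    (i' = i ∧ k' = k ∧ s' = s) ∨ (i' = twin G w (i + k) ∧ k' = k ∧ s' = k - s) := by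
  rcases h.eq_or_eq_twin hv with h1 | h1
  · exact Or.inl (hr'.eq_of_add_eq hr hs' hs h1)
  · refine Or.inr (hr'.eq_of_add_eq hr.reverse hs' (Nat.sub_le _ _) ?_)
    rw [h1, hr.twin_add hs, hr.twin_add le_rfl, Nat.cast_sub hs]
    ring

theorem ne_reverse (hr : h.IsRun i k) : i ≠ twin G w (i + k) := by
  intro hc
  refine h.not_fold hr.double hr.twin_ne ?_
  rw [hr.twin_add le_rfl, eq_sub_iff_add_eq] at hc
  exact hc.symm

theorem source_injOn (hr : h.IsRun i k) {s t : ℕ} (hs : s ≤ k) (ht : t ≤ k)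
    (hv : G.source (w (i + s)) = G.source (w (i + t))) : s = t := by
  rcases hr.eq_or_eq_reverse hr ht hs hv with h1 | h1
  · exact h1.2.2
  · exact absurd h1.1 hr.ne_reverse

/-- Inner vertices of a run are visited only at doubled positions; each of its two ends has one
visit on the adjoining cycle. -/
theorem eq_of_not_isDouble (hr : h.IsRun i k) {s : ℕ} (hs : s ≤ k) {p : Fin n}
    (hp : ¬ h.IsDouble p) (hv : G.source (w p) = G.source (w (i + s))) :
    (s = 0 ∧ p = twin G w i) ∨ (s = k ∧ p = i + k) := by
  rcases h.eq_or_eq_twin hv with rfl | rfl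
  · right
    by_cases hsk : s = k
    · exact ⟨hsk, by rw [hsk]⟩
    · exact absurd (hr.double s (by omega)) hp
  · left
    by_cases hs0 : s = 0
    · exact ⟨hs0, by rw [hs0]; simp⟩
    · exact absurd (hr.isDouble_twin (by omega) hs) hp

/-- The chord at `i` separates the two end cycles: the run never revisits the vertex of `i`, so `i +
k` stays on the side of `i`, opposite to `twin i`. -/
theorem not_sameCycle (hr : h.IsRun i k) : ¬ h.next.SameCycle (twin G w i) (i + k) := by
  intro hc
  obtain ⟨a, b, hab, hv, ha, hor⟩ := exists_chord hr.twin_ne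
  have key : ∀ s : ℕ, s ≤ k → (i + s ∈ Set.Ico a b ↔ i ∈ Set.Ico a b) := by
    intro s
    induction s with
    | zero => simp
    | succ s ih =>
      intro hs
      rw [← ih (by omega)]
      have e1 : i + ((s + 1 : ℕ) : Fin n) = i + s + 1 := by push_cast; ring
      have hne : G.source (w (i + ((s + 1 : ℕ) : Fin n))) ≠ G.source (w i) := by
        intro he
        have := hr.source_injOn hs (Nat.zero_le k) (by simpa using he)
        omega
      rw [e1] at hne ⊢
      refine mem_Ico_succ hab ?_ ?_
      · intro h1
        rw [h1] at hne
        exact hne ha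
      · intro h1
        rw [h1, ← hv] at hne
        exact hne ha
  have h1 := h.mem_Ico_of_sameCycle hab hv hc
  rw [key k le_rfl] at h1
  rcases hor with ⟨rfl, rfl⟩ | ⟨rfl, rfl⟩ <;> simp [hab, hab.le] at h1

end IsRun

theorem pathVerts_runPath (h : IsMinimalCircuit ε w) (i : Fin n) (k : ℕ) :
    G.pathVerts (runPath G w i k) =
      (List.range (k + 1)).map fun s : ℕ => G.source (w (i + (s : Fin n))) := by
  rw [List.range_succ_eq_map, pathVerts, runPath]
  simp only [List.map_cons, List.map_map, Nat.cast_zero, add_zero, List.cons.injEq, true_and]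
  refine List.map_congr_left fun s _ => ?_
  simp only [Function.comp, h.target_eq]
  congr 2
  push_cast
  ring

theorem mem_pathVerts_runPath (h : IsMinimalCircuit ε w) {i : Fin n} {k : ℕ} {x : V} :
    x ∈ G.pathVerts (runPath G w i k) ↔ ∃ s : ℕ, s ≤ k ∧ G.source (w (i + s)) = x := by
  rw [h.pathVerts_runPath, List.mem_map]
  simp

theorem pathLast_runPath (h : IsMinimalCircuit ε w) (i : Fin n) (k : ℕ) :
    G.pathLast (runPath G w i k) = G.source (w (i + k)) := by
  unfold pathLast
  simp only [h.pathVerts_runPath]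
  rw [List.getLast_eq_getElem]
  simp

theorem IsRun.isSimplePath {h : IsMinimalCircuit ε w} {i : Fin n} {k : ℕ} (hr : h.IsRun i k) :
    G.IsSimplePath (runPath G w i k) := by
  refine ⟨?_, fun hne => ?_, ?_⟩
  · rw [IsWalk, List.isChain_iff_getElem]
    intro t ht
    simp only [runPath, List.getElem_map, List.getElem_range]
    rw [h.target_eq]
    congr 2
    push_cast
    ring
  · rw [List.head_eq_getElem]
    simp [runPath]
  · rw [h.pathVerts_runPath]
    refine List.Nodup.map_on (fun a ha b hb hab => ?_) List.nodup_range
    rw [List.mem_range] at ha hb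
    exact hr.source_injOn (by omega) (by omega) hab

/-- The block paths: maximal runs, in one of the two possible directions. -/
def blockPaths (h : IsMinimalCircuit ε w) : Set (PathData V E) :=
  {P | ∃ i k, h.IsRun i k ∧ i ≤ twin G w (i + k) ∧ P = runPath G w i k}

theorem IsRun.exists_blockPath {h : IsMinimalCircuit ε w} {i : Fin n} {k : ℕ} (hr : h.IsRun i k) :
    runPath G w i k ∈ h.blockPaths ∨ runPath G w (twin G w (i + k)) k ∈ h.blockPaths := by
  rcases le_total i (twin G w (i + k)) with hle | hle
  · exact Or.inl ⟨i, k, hr, hle, rfl⟩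
  · refine Or.inr ⟨_, k, hr.reverse, ?_, rfl⟩
    have : twin G w (twin G w (i + k) + k) = i := by
      rw [hr.twin_add le_rfl, sub_add_cancel, h.twin_twin]
    rwa [this]

theorem blockPaths_disjoint (h : IsMinimalCircuit ε w) {P P' : PathData V E}
    (hP : P ∈ h.blockPaths) (hP' : P' ∈ h.blockPaths) {x : V} (hx : x ∈ G.pathVerts P)
    (hx' : x ∈ G.pathVerts P') : P = P' := by
  obtain ⟨i, k, hr, hle, rfl⟩ := hP
  obtain ⟨i', k', hr', hle', rfl⟩ := hP'
  obtain ⟨s, hs, rfl⟩ := h.mem_pathVerts_runPath.mp hx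
  obtain ⟨s', hs', hv⟩ := h.mem_pathVerts_runPath.mp hx'
  rcases hr.eq_or_eq_reverse hr' hs hs' hv with ⟨rfl, rfl, -⟩ | ⟨rfl, rfl, -⟩
  · rfl
  · have : twin G w (twin G w (i + k') + k') = i := by
      rw [hr.twin_add le_rfl, sub_add_cancel, h.twin_twin]
    rw [this] at hle'
    exact absurd (le_antisymm hle hle') hr.ne_reverse

/-- Were all positions doubled, the run from `0` to its twin would fold back onto itself. -/
theorem exists_not_isDouble (h : IsMinimalCircuit ε w) : ∃ i, ¬ h.IsDouble i := by
  by_contra! hc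
  refine h.not_fold (i := 0) (k := (twin G w 0).val) (fun s _ => hc _) (hc 0).twin_ne ?_
  simp

theorem exists_isRun (h : IsMinimalCircuit ε w) {i : Fin n} (hi : twin G w i ≠ i)
    (hb : ¬ h.IsDouble (i - 1)) : ∃ k, h.IsRun i k := by
  classical
  obtain ⟨q, hq⟩ := h.exists_not_isDouble
  have hex : ∃ s : ℕ, ¬ h.IsDouble (i + s) := ⟨(q - i).val, by simpa using hq⟩
  exact ⟨Nat.find hex, fun s hs => not_not.mp (Nat.find_min hex hs), hi, hb, Nat.find_spec hex⟩

theorem IsDouble.exists_isRun {h : IsMinimalCircuit ε w} {i : Fin n} (hi : h.IsDouble i) :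
    ∃ j k, h.IsRun j k ∧ ∃ s : ℕ, s < k ∧ i = j + s := by
  classical
  obtain ⟨q, hq⟩ := h.exists_not_isDouble
  have hex : ∃ s : ℕ, ¬ h.IsDouble (i - s) := ⟨(i - q).val, by simpa using hq⟩
  have hmin : ∀ s : ℕ, s < Nat.find hex → h.IsDouble (i - s) :=
    fun s hs => not_not.mp (Nat.find_min hex hs)
  -- Going back from `i`, the first position that is not doubled is `i - (r + 1)`, so the run starts
  -- at `i - r`.
  obtain ⟨r, hr⟩ : ∃ r, Nat.find hex = r + 1 := by
    refine Nat.exists_eq_succ_of_ne_zero fun h0 => ?_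
    have := Nat.find_spec hex
    rw [h0] at this
    simp only [Nat.cast_zero, sub_zero] at this
    exact this hi
  have hspec := Nat.find_spec hex
  rw [hr] at hmin hspec
  have hb : ¬ h.IsDouble (i - r - 1) := by
    convert hspec using 2
    push_cast
    ring
  obtain ⟨k, hk⟩ := h.exists_isRun (hmin r (by omega)).twin_ne hb
  refine ⟨i - r, k, hk, r, not_le.mp fun hc => hk.after ?_, by ring⟩
  have h1 := hmin (r - k) (by omega)
  rw [Nat.cast_sub hc] at h1
  convert h1 using 1
  ring

end IsMinimalCircuit

end BlockPaths

/-! ### The Eulerian cycle-tree of a minimal circuit. -/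

section CycleTreeOfCircuit

variable {V E : Type*} [Fintype E] [DecidableEq V] [DecidableEq E] {G : SignedGraph V E}
  {ε : G.Orientation} {n : ℕ} [NeZero n] {w : Fin n → E × Bool}

namespace IsMinimalCircuit

theorem isCycle_iff (h : IsMinimalCircuit ε w) {C : Finset E} :
    (G.IsCycle C ∧ C ⊆ Finset.univ.image fun i => (w i).1) ↔
      ∃ k, ¬ h.IsDouble k ∧ C = h.region k := by
  constructor
  · rintro ⟨hC, hS⟩
    exact h.cycle_eq_region hC fun e he => mem_image_fst.mp (hS he)
  · rintro ⟨k, hk, rfl⟩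
    refine ⟨h.isCycle_region hk, fun e he => ?_⟩
    obtain ⟨i, -, hi⟩ := h.mem_region.mp he
    exact mem_image_fst.mpr ⟨i, hi⟩

theorem not_sameCycle_of_region_ne (h : IsMinimalCircuit ε w) {k l : Fin n}
    (hne : h.region k ≠ h.region l) : ¬ h.next.SameCycle k l :=
  fun hc => hne (h.region_eq_of_sameCycle hc)

theorem region_ne (h : IsMinimalCircuit ε w) {k l : Fin n} (hl : ¬ h.IsDouble l)
    (hkl : ¬ h.next.SameCycle k l) : h.region k ≠ h.region l :=
  fun hc => hkl (h.sameCycle_of_mem_region hl (hc ▸ h.mem_region_self l))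

theorem region_disjoint (h : IsMinimalCircuit ε w) {k l : Fin n} (hl : ¬ h.IsDouble l)
    (hkl : ¬ h.next.SameCycle k l) : Disjoint (h.region k) (h.region l) := by
  rw [Finset.disjoint_left]
  intro e he he'
  obtain ⟨i, hi, rfl⟩ := h.mem_region.mp he'
  exact hkl ((h.sameCycle_of_mem_region
    (fun hc => hl ((h.isDouble_iff_of_sameCycle hi).mpr hc)) he).trans hi.symm)

/-- A common vertex of two regions is visited at two positions, neither being on a double edge. -/
theorem exists_position_of_mem_verts (h : IsMinimalCircuit ε w) {k l : Fin n}
    (hk : ¬ h.IsDouble k) (hl : ¬ h.IsDouble l) (hkl : ¬ h.next.SameCycle k l) {x : V}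
    (hx : x ∈ G.verts (h.region k) ∩ G.verts (h.region l)) :
    ∃ i, G.source (w i) = x ∧ h.IsRun i 0 := by
  obtain ⟨hx1, hx2⟩ := hx
  obtain ⟨a, ha, rfl⟩ := h.mem_verts_region.mp hx1
  obtain ⟨b, hb, hab⟩ := h.mem_verts_region.mp hx2
  have hne : b ≠ a := by
    rintro rfl
    exact hkl (ha.trans hb.symm)
  have hbt : b = twin G w a := (h.eq_or_eq_twin hab).resolve_left hne
  refine ⟨a, rfl, fun s hs => absurd hs (Nat.not_lt_zero s), twin_ne hne hab, ?_, ?_⟩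
  · rw [← isDouble_next_iff, next_sub_one, ← hbt, ← h.isDouble_iff_of_sameCycle hb]
    exact hl
  · rw [Nat.cast_zero, add_zero, ← h.isDouble_iff_of_sameCycle ha]
    exact hk

theorem IsRun.inter_first {h : IsMinimalCircuit ε w} {i : Fin n} {k : ℕ} (hr : h.IsRun i k) :
    G.verts (h.region (twin G w i)) ∩ {v | v ∈ G.pathVerts (runPath G w i k)} =
      {G.source (w i)} := by
  ext x
  simp only [Set.mem_inter_iff, Set.mem_ofPred_eq, Set.mem_singleton_iff]
  rw [h.mem_verts_region, h.mem_pathVerts_runPath]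
  constructor
  · rintro ⟨⟨p, hp, rfl⟩, s, hs, hv⟩
    have hpd : ¬ h.IsDouble p := by
      rw [← h.isDouble_iff_of_sameCycle hp]
      exact hr.not_isDouble_twin
    rcases hr.eq_of_not_isDouble hs hpd hv.symm with ⟨-, rfl⟩ | ⟨-, rfl⟩
    · exact source_twin G w i
    · exact absurd hp hr.not_sameCycle
  · rintro rfl
    exact ⟨⟨_, Equiv.Perm.SameCycle.refl _ _, source_twin G w i⟩, 0, Nat.zero_le _, by simp⟩

theorem IsRun.inter_last {h : IsMinimalCircuit ε w} {i : Fin n} {k : ℕ} (hr : h.IsRun i k) :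
    G.verts (h.region (i + k)) ∩ {v | v ∈ G.pathVerts (runPath G w i k)} =
      {G.pathLast (runPath G w i k)} := by
  ext x
  simp only [Set.mem_inter_iff, Set.mem_ofPred_eq, Set.mem_singleton_iff]
  rw [h.mem_verts_region, h.mem_pathVerts_runPath, h.pathLast_runPath]
  constructor
  · rintro ⟨⟨p, hp, rfl⟩, s, hs, hv⟩
    have hpd : ¬ h.IsDouble p := by
      rw [← h.isDouble_iff_of_sameCycle hp]
      exact hr.after
    rcases hr.eq_of_not_isDouble hs hpd hv.symm with ⟨-, rfl⟩ | ⟨-, rfl⟩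
    · exact absurd hp.symm hr.not_sameCycle
    · rfl
  · rintro rfl
    exact ⟨⟨_, Equiv.Perm.SameCycle.refl _ _, rfl⟩, k, le_rfl, rfl⟩

theorem twin_ne_of_isIntersection (h : IsMinimalCircuit ε w) {x : V}
    (hx : (∃ C, (∃ k, ¬ h.IsDouble k ∧ C = h.region k) ∧ ∃ C', (∃ k, ¬ h.IsDouble k ∧
      C' = h.region k) ∧ C ≠ C' ∧ x ∈ G.verts C ∩ G.verts C') ∨
      ∃ P ∈ h.blockPaths, x = P.first ∨ x = G.pathLast P) :
    ∃ i, twin G w i ≠ i ∧ G.source (w i) = x := by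
  rcases hx with ⟨_, ⟨k, hk, rfl⟩, _, ⟨l, hl, rfl⟩, hne, hx⟩ | ⟨_, ⟨i, k, hr, -, rfl⟩, rfl | rfl⟩
  · obtain ⟨i, hi, hr⟩ :=
      h.exists_position_of_mem_verts hk hl (h.not_sameCycle_of_region_ne hne) hx
    exact ⟨i, hr.twin_ne, hi⟩
  · exact ⟨i, hr.twin_ne, rfl⟩
  · refine ⟨_, hr.reverse.twin_ne, ?_⟩
    rw [source_twin, h.pathLast_runPath]

/-- The cycle-tree formed by the edges of a minimal circuit. -/
noncomputable def cycleTree (h : IsMinimalCircuit ε w) : CycleTree G where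
  edges := Finset.univ.image fun i => (w i).1
  connected := by
    refine ⟨⟨_, mem_image_fst.mpr ⟨0, rfl⟩⟩, fun e he e' he' => ?_⟩
    obtain ⟨i, rfl⟩ := mem_image_fst.mp he
    obtain ⟨j, rfl⟩ := mem_image_fst.mp he'
    exact h.linked_empty (fun i => mem_image_fst.mpr ⟨i, rfl⟩) i j
  cycles := {C | ∃ k, ¬ h.IsDouble k ∧ C = h.region k}
  paths := h.blockPaths
  paths_simple := by
    rintro _ ⟨i, k, hr, -, rfl⟩
    exact hr.isSimplePath
  paths_subset := by
    rintro _ ⟨i, k, hr, -, rfl⟩ d hd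
    obtain ⟨s, -, hs⟩ := mem_steps_runPath.mp (List.mem_map_of_mem (f := Prod.fst) hd)
    exact mem_image_fst.mpr ⟨_, hs⟩
  cover := by
    intro e he
    obtain ⟨i, rfl⟩ := mem_image_fst.mp he
    by_cases hi : h.IsDouble i
    · right
      obtain ⟨j, k, hr, s, hs, rfl⟩ := hi.exists_isRun
      rcases hr.exists_blockPath with hP | hP
      · exact ⟨_, hP, mem_steps_runPath.mpr ⟨s, hs, rfl⟩⟩
      -- In the reversed run, the edge number `s` out of `k` has number `k - 1 - s`; there the
      -- circuit is at `next (j + s)`.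
      · refine ⟨_, hP, mem_steps_runPath.mpr ⟨k - (s + 1), by omega, ?_⟩⟩
        have h1 : twin G w (j + k) + ((k - (s + 1) : ℕ) : Fin n) = h.next (j + s) := by
          have e1 : j + (s : Fin n) + 1 = j + ((s + 1 : ℕ) : Fin n) := by push_cast; ring
          rw [next_apply, e1, hr.twin_add le_rfl, hr.twin_add (by omega), Nat.cast_sub (by omega)]
          ring
        rw [h1, hi, stepRev_fst]
    · exact Or.inl ⟨_, ⟨i, hi, rfl⟩, h.mem_region_self i⟩
  cycles_disjoint := by
    rintro _ ⟨k, hk, rfl⟩ _ ⟨l, hl, rfl⟩ hne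
    exact h.region_disjoint hl (h.not_sameCycle_of_region_ne hne)
  paths_disjoint := by
    intro P hP P' hP' hne x hx hx'
    exact hne (h.blockPaths_disjoint hP hP' hx hx')
  cycles_paths_disjoint := by
    rintro _ ⟨k, hk, rfl⟩ _ ⟨i, l, hr, -, rfl⟩ e he he'
    obtain ⟨p, hp, rfl⟩ := h.mem_region.mp he
    obtain ⟨s, hs, he⟩ := mem_steps_runPath.mp he'
    rw [h.isDouble_iff_of_sameCycle hp, ← h.isDouble_iff_of_fst_eq he] at hk
    exact hk (hr.double s hs)
  mem_cycles_iff C := h.isCycle_iff.symm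
  cycles_inter := by
    rintro _ ⟨k, hk, rfl⟩ _ ⟨l, hl, rfl⟩ hne
    exact h.region_inter_subsingleton (h.not_sameCycle_of_region_ne hne)
  zero_path := by
    rintro _ ⟨k, hk, rfl⟩ _ ⟨l, hl, rfl⟩ hne x hx
    obtain ⟨i, rfl, hr⟩ :=
      h.exists_position_of_mem_verts hk hl (h.not_sameCycle_of_region_ne hne) hx
    have h1 := hr.exists_blockPath
    simpa [runPath, source_twin] using h1
  paths_inter := by
    rintro _ ⟨i, k, hr, -, rfl⟩
    -- The cycle at the start contains `twin G w i`, because `i` itself is doubled when the run has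
    -- positive length; the cycle at the end contains `i + k`.
    refine ⟨_, ⟨_, hr.not_isDouble_twin, rfl⟩, _, ⟨_, hr.after, rfl⟩,
      h.region_ne hr.after hr.not_sameCycle, hr.inter_first, hr.inter_last, ?_⟩
    rintro _ ⟨l, hl, rfl⟩ ⟨x, hx, hx'⟩
    obtain ⟨p, hp, rfl⟩ := h.mem_verts_region.mp hx
    obtain ⟨s, hs, hv⟩ := h.mem_pathVerts_runPath.mp hx'
    rw [h.isDouble_iff_of_sameCycle hp] at hl
    rcases hr.eq_of_not_isDouble hs hl hv.symm with ⟨-, rfl⟩ | ⟨-, rfl⟩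
    · exact Or.inl (h.region_eq_of_sameCycle hp)
    · exact Or.inr (h.region_eq_of_sameCycle hp)
  cutPoint := by
    intro x hx
    obtain ⟨i, hi, rfl⟩ := h.twin_ne_of_isIntersection hx
    exact h.isCutPoint (fun e => mem_image_fst) hi

/-- A chord at a position on a cycle starts a run at its twin, possibly of length zero, so its
vertex is an end of a block path. -/
theorem isIntersectionVertex_iff (h : IsMinimalCircuit ε w) {i : Fin n} (hi : ¬ h.IsDouble i) :
    h.cycleTree.IsIntersectionVertex (G.source (w i)) ↔ twin G w i ≠ i := by
  constructor
  · intro hx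
    obtain ⟨j, hj, hv⟩ := h.twin_ne_of_isIntersection hx
    rcases h.eq_or_eq_twin hv with rfl | rfl
    · exact hj
    · rwa [h.twin_ne_self_iff] at hj
  · intro ht
    have hb : ¬ h.IsDouble (twin G w i - 1) := by
      rw [← isDouble_next_iff, next_sub_one, h.twin_twin]
      exact hi
    obtain ⟨k, hr⟩ := h.exists_isRun (h.twin_ne_self_iff.mpr ht) hb
    right
    rcases hr.exists_blockPath with hP | hP
    · exact ⟨_, hP, Or.inl (source_twin G w i).symm⟩
    · refine ⟨_, hP, Or.inr ?_⟩
      rw [h.pathLast_runPath, hr.twin_add le_rfl, sub_add_cancel, h.twin_twin]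

/-- A region visits each of its vertices once, so its intersection vertices are counted by the
exponent in `prod_sign_region`. -/
theorem cycleTree_isEulerian (h : IsMinimalCircuit ε w) : h.cycleTree.IsEulerian := by
  classical
  rintro _ ⟨k, hk, rfl⟩
  have hset : {v | v ∈ G.verts (h.region k) ∧ h.cycleTree.IsIntersectionVertex v} =
      (fun i => G.source (w i)) ''
        (Finset.univ.filter fun i => h.next.SameCycle k i ∧ twin G w i ≠ i : Finset (Fin n)) := by
    ext x
    simp only [Set.mem_ofPred_eq, Set.mem_image, Finset.mem_coe, Finset.mem_filter,
      Finset.mem_univ, true_and, h.mem_verts_region]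
    constructor
    · rintro ⟨⟨i, hi, rfl⟩, hx⟩
      rw [h.isIntersectionVertex_iff ((h.isDouble_iff_of_sameCycle hi).not.mp hk)] at hx
      exact ⟨i, ⟨hi, hx⟩, rfl⟩
    · rintro ⟨i, ⟨hi, hx⟩, rfl⟩
      rw [h.isIntersectionVertex_iff ((h.isDouble_iff_of_sameCycle hi).not.mp hk)]
      exact ⟨⟨i, hi, rfl⟩, hx⟩
  have hcard : {v | v ∈ G.verts (h.region k) ∧ h.cycleTree.IsIntersectionVertex v}.ncard =
      (Finset.univ.filter fun i => h.next.SameCycle k i ∧ twin G w i ≠ i).card := by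
    rw [hset, Set.InjOn.ncard_image, Set.ncard_coe_finset]
    intro a ha b hb hab
    simp only [Finset.mem_coe, Finset.mem_filter, Finset.mem_univ, true_and] at ha hb
    exact h.eq_of_sameCycle (ha.1.symm.trans hb.1) hab
  rw [hcard]
  have hp := h.prod_sign_region hk
  refine ⟨fun hb => ?_, fun hb => ?_⟩
  · by_contra hodd
    rw [hb.2, (Nat.not_even_iff_odd.mp hodd).neg_one_pow] at hp
    exact absurd hp (by decide)
  · by_contra heven
    rw [hb.2, (Nat.not_odd_iff_even.mp heven).neg_one_pow] at hp
    exact absurd hp (by decide)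

theorem cycleTree_indicator (h : IsMinimalCircuit ε w) (e : E) :
    h.cycleTree.indicator e = ((Finset.univ.filter fun i => (w i).1 = e).card : ℤ) := by
  by_cases he : ∃ i, (w i).1 = e
  · obtain ⟨i, rfl⟩ := he
    by_cases hi : h.IsDouble i
    · have h1 : ¬ ∃ C ∈ h.cycleTree.cycles, (w i).1 ∈ C := by
        rintro ⟨_, ⟨k, hk, rfl⟩, hm⟩
        obtain ⟨p, hp, hpe⟩ := h.mem_region.mp hm
        rw [h.isDouble_iff_of_sameCycle hp, h.isDouble_iff_of_fst_eq hpe] at hk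
        exact hk hi
      have h2 : ∃ P ∈ h.cycleTree.paths, (w i).1 ∈ P.steps.map Prod.fst :=
        (h.cycleTree.cover _ (mem_image_fst.mpr ⟨i, rfl⟩)).resolve_left h1
      rw [CycleTree.indicator, if_neg h1, if_pos h2]
      have h3 : (Finset.univ.filter fun j => (w j).1 = (w i).1) = {i, h.next i} := by
        ext j
        simp only [Finset.mem_filter, Finset.mem_univ, true_and, Finset.mem_insert,
          Finset.mem_singleton]
        constructor
        · intro hj
          exact (h.eq_or_eq_next hj).imp_right And.left
        · rintro (rfl | rfl)
          · rfl
          · rw [hi, stepRev_fst]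
      rw [h3, Finset.card_pair hi.next_ne.symm]
      rfl
    · have h1 : ∃ C ∈ h.cycleTree.cycles, (w i).1 ∈ C :=
        ⟨_, ⟨i, hi, rfl⟩, h.mem_region_self i⟩
      rw [CycleTree.indicator, if_pos h1]
      have h3 : (Finset.univ.filter fun j => (w j).1 = (w i).1) = {i} := by
        ext j
        simp only [Finset.mem_filter, Finset.mem_univ, true_and, Finset.mem_singleton]
        constructor
        · exact h.eq_of_fst_eq_of_not_isDouble hi
        · rintro rfl
          rfl
      rw [h3, Finset.card_singleton]
      rfl
  · have h1 : ¬ ∃ C ∈ h.cycleTree.cycles, e ∈ C := by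
      rintro ⟨_, ⟨k, hk, rfl⟩, hm⟩
      obtain ⟨p, -, hpe⟩ := h.mem_region.mp hm
      exact he ⟨p, hpe⟩
    have h2 : ¬ ∃ P ∈ h.cycleTree.paths, e ∈ P.steps.map Prod.fst := by
      rintro ⟨_, ⟨i, k, hr, -, rfl⟩, hm⟩
      obtain ⟨s, -, hs⟩ := mem_steps_runPath.mp hm
      exact he ⟨_, hs⟩
    have h3 : (Finset.univ.filter fun j => (w j).1 = e) = ∅ := by
      ext j
      simp only [Finset.mem_filter, Finset.mem_univ, true_and, Finset.notMem_empty, iff_false]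
      exact fun hj => he ⟨j, hj⟩
    rw [CycleTree.indicator, if_neg h1, if_neg h2, h3]
    rfl

end IsMinimalCircuit

end CycleTreeOfCircuit


/-! ### Walks along the arrows are directed Eulerian walks. -/

section DirectedWalks

variable {V E : Type*}

/-- The step `d'` may follow the step `d` in a walk along the arrows of `ε`. -/
def Follows {G : SignedGraph V E} (ε : G.Orientation) (d d' : E × Bool) : Prop :=
  G.target d = G.source d' ∧ ε.arrow (stepRev d) = -ε.arrow d'

/-- Closed walks along the arrows of `ε`. -/
def IsCircuit {G : SignedGraph V E} (ε : G.Orientation) (W : List (E × Bool)) : Prop :=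
  W.IsChain (Follows ε) ∧ ∃ hne : W ≠ [], Follows ε (W.getLast hne) (W.head hne)

theorem isDirectedClosedWalk_onWalk_iff {G : SignedGraph V E} {ε : G.Orientation}
    {W : List (E × Bool)} : G.IsDirectedClosedWalk W (ε.onWalk W) ↔ IsCircuit ε W := by
  constructor
  · rintro ⟨⟨hW, hne, hcl⟩, ⟨-, hd⟩, hd0⟩
    have hpos := List.length_pos_iff.mpr hne
    rw [IsWalk, List.isChain_iff_getElem] at hW
    refine ⟨?_, hne, hcl.symm, ?_⟩
    · rw [List.isChain_iff_getElem]
      exact fun t ht => ⟨hW t ht, hd ⟨t, by omega⟩ ⟨t + 1, ht⟩ rfl⟩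
    · rw [List.getLast_eq_getElem, List.head_eq_getElem]
      exact hd0 ⟨0, hpos⟩ ⟨W.length - 1, by omega⟩ rfl (Nat.sub_add_cancel hpos)
  · rintro ⟨hW, hne, hcl⟩
    have hpos := List.length_pos_iff.mpr hne
    rw [List.isChain_iff_getElem] at hW
    refine ⟨⟨?_, hne, hcl.1.symm⟩, ⟨fun i => ε.mul_eq _, ?_⟩, ?_⟩
    · rw [IsWalk, List.isChain_iff_getElem]
      exact fun t ht => (hW t ht).1
    · rintro ⟨i, hi⟩ ⟨j, hj⟩ hij
      simp only at hij
      subst hij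
      exact (hW i hj).2
    · rintro ⟨i, hi⟩ ⟨j, hj⟩ h1 h2
      simp only at h1 h2
      subst h1
      have h3 := hcl.2
      rw [List.getLast_eq_getElem, List.head_eq_getElem] at h3
      have h4 : j = W.length - 1 := by omega
      subst h4
      exact h3

theorem card_filter_get [DecidableEq E] (W : List (E × Bool)) (e : E) :
    (Finset.univ.filter fun i : Fin W.length => (W.get i).1 = e).card =
      (W.map Prod.fst).count e := by
  induction W with
  | nil => rfl
  | cons d W ih =>
    have h1 := Fin.card_filter_univ_succ (fun i : Fin (W.length + 1) => ((d :: W).get i).1 = e)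
    have h2 : (Finset.univ.filter fun i : Fin W.length => ((d :: W).get i.succ).1 = e).card =
        (W.map Prod.fst).count e := ih
    rw [h2] at h1
    rw [List.map_cons, List.count_cons]
    refine h1.trans ?_
    by_cases hd : d.1 = e <;> simp [hd]

theorem count_ne_zero [DecidableEq E] {W : List (E × Bool)} (hne : W ≠ []) :
    (fun e => (W.map Prod.fst).count e) ≠ 0 := by
  intro h
  have := congrFun h (W.head hne).1
  rw [Pi.zero_apply, List.count_eq_zero] at this
  exact this (List.mem_map_of_mem (List.head_mem hne))

/-- Each edge sign is the product of two consecutive departing arrows, so every arrow occurs twice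
around the circuit. -/
theorem walkSign_of_isCircuit {G : SignedGraph V E} {ε : G.Orientation} {W : List (E × Bool)}
    (hW : IsCircuit ε W) : G.walkSign W = 1 := by
  obtain ⟨hc, hne, hcl⟩ := hW
  have := neZero_length hne
  have h1 : ∀ i : Fin W.length, G.sign (W.get i).1 = ε.arrow (W.get i) * ε.arrow (W.get (i + 1)) := by
    intro i
    have h2 := arrow_mul_arrow_stepRev ε (W.get i)
    rw [(isChain_cyclic hc hne hcl i).2] at h2
    rw [← neg_inj, ← h2, mul_neg]
  have h3 : G.walkSign W = ∏ i : Fin W.length, G.sign (W.get i).1 := by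
    conv_lhs => rw [walkSign, ← List.ofFn_get W, List.map_ofFn, List.prod_ofFn]
    rfl
  have h4 : ∏ i : Fin W.length, ε.arrow (W.get (i + 1)) = ∏ i : Fin W.length, ε.arrow (W.get i) :=
    Equiv.prod_comp (Equiv.addRight (1 : Fin W.length)) fun i => ε.arrow (W.get i)
  rw [h3, Finset.prod_congr rfl fun i _ => h1 i, Finset.prod_mul_distrib,
    h4, Int.units_mul_self]

/-- The directions of a walk are unique up to a global sign. -/
theorem IsDirection.eq_smul {G : SignedGraph V E} {ε : G.Orientation} {W : List (E × Bool)}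
    (hc : W.IsChain (Follows ε)) {δ : Fin W.length → Bool → ℤˣ} (hδ : G.IsDirection W δ) :
    ∃ c : ℤˣ, ∀ i b, δ i b = c * ε.val (W.get i).1 b := by
  rw [List.isChain_iff_getElem] at hc
  obtain ⟨h1, h2⟩ := hδ
  have other : ∀ (c : ℤˣ) i b, δ i b = c * ε.val (W.get i).1 b →
      ∀ b', δ i b' = c * ε.val (W.get i).1 b' := by
    intro c i b hb b'
    have h3 := (h1 i).trans (ε.mul_eq (W.get i).1).symm
    generalize ε.val (W.get i).1 = y at h3 hb ⊢
    generalize δ i = x at h3 hb ⊢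
    by_cases hbb : b' = b
    · rw [hbb, hb]
    · have h4 : x b * x b' = y b * y b' := by
        cases b <;> cases b' <;> simp_all [mul_comm]
      rw [hb] at h4
      refine mul_left_cancel (a := c * y b) ?_
      rw [h4, mul_mul_mul_comm, Int.units_mul_self, one_mul]
  rcases Nat.eq_zero_or_pos W.length with h0 | h0
  · exact ⟨1, fun i => absurd i.isLt (by omega)⟩
  · refine ⟨δ ⟨0, h0⟩ true * ε.val (W.get ⟨0, h0⟩).1 true, ?_⟩
    rintro ⟨i, hi⟩
    induction i with
    | zero =>
      refine other _ _ true ?_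
      rw [mul_assoc, Int.units_mul_self, mul_one]
    | succ i ih =>
      refine other _ _ (W.get ⟨i + 1, hi⟩).2 ?_
      have h4 := h2 ⟨i, by omega⟩ ⟨i + 1, hi⟩ rfl
      rw [ih (by omega), ← neg_eq_iff_eq_neg] at h4
      rw [← h4, ← mul_neg]
      congr 1
      rw [neg_eq_iff_eq_neg]
      exact (hc i hi).2

theorem IsCircuit.isDirectedEulerianWalk {G : SignedGraph V E} {ε : G.Orientation}
    {W : List (E × Bool)} (hW : IsCircuit ε W) : G.IsDirectedEulerianWalk W (ε.onWalk W) := by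
  have h1 := isDirectedClosedWalk_onWalk_iff.mpr hW
  refine ⟨⟨h1.1, walkSign_of_isCircuit hW, fun δ hδ i j hij => ?_⟩, h1⟩
  obtain ⟨c, hc⟩ := hδ.eq_smul hW.1
  ext b
  rw [hc, hc, hij]

end DirectedWalks

/-! ### Minimal nonnegative flows and the circuits that realise them. -/

section NonnegativeFlows

variable {V E : Type*} [Fintype E] [DecidableEq V] {G : SignedGraph V E} {ε : G.Orientation}

theorem boundary_add (f g : E → ℤ) (u : V) :
    boundary ε (fun e => f e + g e) u = boundary ε f u + boundary ε g u := by
  unfold boundary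
  rw [← Finset.sum_add_distrib]
  refine Finset.sum_congr rfl fun e _ => ?_
  rw [← Finset.sum_add_distrib]
  refine Finset.sum_congr rfl fun b _ => ?_
  split_ifs <;> ring

theorem boundary_sub (f g : E → ℤ) (u : V) :
    boundary ε (fun e => f e - g e) u = boundary ε f u - boundary ε g u := by
  have := boundary_add (ε := ε) (fun e => f e - g e) g u
  simp only [sub_add_cancel] at this
  exact eq_sub_of_add_eq this.symm

/-- The nonzero nonnegative flows that have no smaller nonzero nonnegative flow below. -/
structure IsMinimalFlow (ε : G.Orientation) (g : E → ℕ) : Prop where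
  isFlow : IsFlow ε fun e => (g e : ℤ)
  ne_zero : g ≠ 0
  minimal : ∀ g' : E → ℕ, IsFlow ε (fun e => (g' e : ℤ)) → g' ≠ 0 → g' ≤ g → g' = g

theorem exists_isMinimalFlow_le {h : E → ℕ} (hf : IsFlow ε fun e => (h e : ℤ)) (h0 : h ≠ 0) :
    ∃ g ≤ h, IsMinimalFlow ε g := by
  obtain ⟨g, ⟨hg, hg0, hgh⟩, hmin⟩ :=
    (measure fun g : E → ℕ => ∑ e, g e).wf.has_min
      {g | IsFlow ε (fun e => (g e : ℤ)) ∧ g ≠ 0 ∧ g ≤ h} ⟨h, hf, h0, le_rfl⟩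
  refine ⟨g, hgh, hg, hg0, fun g' hg' hg0' hle => ?_⟩
  have h1 : ¬ (∑ e, g' e) < ∑ e, g e := hmin g' ⟨hg', hg0', hle.trans hgh⟩
  have h2 := (Finset.sum_eq_sum_iff_of_le fun e (_ : e ∈ Finset.univ) => hle e).mp
    (le_antisymm (Finset.sum_le_sum fun e _ => hle e) (not_lt.mp h1))
  exact funext fun e => h2 e (Finset.mem_univ e)

theorem isFlow_sub {g h : E → ℕ} (hh : IsFlow ε fun e => (h e : ℤ))
    (hg : IsFlow ε fun e => (g e : ℤ)) (hle : g ≤ h) :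
    IsFlow ε fun e => (((h - g) e : ℕ) : ℤ) := by
  intro u
  have h1 : (fun e => (((h - g) e : ℕ) : ℤ)) = fun e => (h e : ℤ) - (g e : ℤ) := by
    funext e
    rw [Pi.sub_apply, Nat.cast_sub (hle e)]
  rw [h1, boundary_sub, hh u, hg u, sub_self]

theorem exists_sum_isMinimalFlow (h : E → ℕ) (hf : IsFlow ε fun e => (h e : ℤ)) :
    ∃ L : List (E → ℕ), (∀ g ∈ L, IsMinimalFlow ε g) ∧ h = L.sum := by
  induction hn : ∑ e, h e using Nat.strong_induction_on generalizing h with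
  | _ n ih =>
    by_cases h0 : h = 0
    · exact ⟨[], by simp, by simpa using h0⟩
    · obtain ⟨g, hle, hg⟩ := exists_isMinimalFlow_le hf h0
      have h1 : ∑ e, (h - g) e < n := by
        obtain ⟨e, he⟩ := Function.ne_iff.mp hg.ne_zero
        rw [← hn]
        refine Finset.sum_lt_sum (fun e _ => Nat.sub_le _ _) ⟨e, Finset.mem_univ e, ?_⟩
        have := hle e
        simp only [Pi.sub_apply, Pi.zero_apply] at *
        omega
      obtain ⟨L, hL, hs⟩ := ih _ h1 (h - g) (isFlow_sub hf hg.isFlow hle) rfl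
      refine ⟨g :: L, ?_, ?_⟩
      · simpa using ⟨hg, hL⟩
      · rw [List.sum_cons, ← hs]
        exact (add_tsub_cancel_of_le hle).symm

variable [DecidableEq E]

theorem boundary_count_cons (d : E × Bool) (W : List (E × Bool)) (u : V) :
    boundary ε (fun e => ((((d :: W).map Prod.fst).count e : ℕ) : ℤ)) u =
      ((if G.source d = u then (ε.arrow d : ℤ) else 0) +
        (if G.target d = u then (ε.arrow (stepRev d) : ℤ) else 0)) +
      boundary ε (fun e => (((W.map Prod.fst).count e : ℕ) : ℤ)) u := by
  simp only [← card_filter_get, boundary_count]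
  exact Fin.sum_univ_succ (n := W.length) _

theorem boundary_count_of_isChain {W : List (E × Bool)} (hW : W.IsChain (Follows ε))
    (hne : W ≠ []) (u : V) :
    boundary ε (fun e => (((W.map Prod.fst).count e : ℕ) : ℤ)) u =
      (if G.source (W.head hne) = u then (ε.arrow (W.head hne) : ℤ) else 0) +
      (if G.target (W.getLast hne) = u then (ε.arrow (stepRev (W.getLast hne)) : ℤ) else 0) := by
  induction W with
  | nil => exact absurd rfl hne
  | cons d W ih =>
    rw [boundary_count_cons]
    rcases W with _ | ⟨d', W⟩
    · rw [List.head_cons, List.getLast_singleton]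
      simp [boundary]
    · rw [List.isChain_cons_cons] at hW
      rw [ih hW.2 (List.cons_ne_nil _ _)]
      have key : (if G.source d' = u then ((-ε.arrow d' : ℤˣ) : ℤ) else 0) =
          -(if G.source d' = u then (ε.arrow d' : ℤ) else 0) := by
        split_ifs <;> simp
      rw [List.getLast_cons_cons, List.head_cons, List.head_cons, hW.1.1, hW.1.2, key]
      ring

theorem IsCircuit.isFlow {W : List (E × Bool)} (hW : IsCircuit ε W) :
    IsFlow ε fun e => (((W.map Prod.fst).count e : ℕ) : ℤ) := by
  obtain ⟨hc, hne, hcl⟩ := hW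
  intro u
  rw [boundary_count_of_isChain hc hne, hcl.1, hcl.2]
  split_ifs <;> simp

/-- An open walk below a nonnegative flow can be extended at its start. -/
theorem exists_follows_of_not_closed {g : E → ℕ} (hg : IsFlow ε fun e => (g e : ℤ))
    {W : List (E × Bool)} (hW : W.IsChain (Follows ε)) (hne : W ≠ [])
    (hle : ∀ e, (W.map Prod.fst).count e ≤ g e)
    (hcl : ¬ Follows ε (W.getLast hne) (W.head hne)) :
    ∃ d, Follows ε d (W.head hne) ∧ (W.map Prod.fst).count d.1 < g d.1 := by
  by_contra! hc
  set x := G.source (W.head hne) with hx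
  set a := ε.arrow (W.head hne) with ha
  -- If no unused edge can enter, the residual flow at `x` lives only on ends with arrow `a`.
  -- Conservation, however, makes its boundary there `-a`, or `-2a` if the walk also ends at `x`.
  have h1 : boundary ε (fun e => (g e : ℤ) - ((W.map Prod.fst).count e : ℕ)) x * a ≥ 0 := by
    unfold boundary
    rw [Finset.sum_mul]
    refine Finset.sum_nonneg fun e _ => ?_
    rw [Finset.sum_mul]
    refine Finset.sum_nonneg fun b _ => ?_
    split_ifs with hb
    · have hr : (0 : ℤ) ≤ (g e : ℤ) - ((W.map Prod.fst).count e : ℕ) := by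
        have := hle e
        omega
      rcases units_eq_or_eq_neg (ε.val e b) a with h2 | h2
      · rw [h2, mul_right_comm, ← Units.val_mul, Int.units_mul_self, Units.val_one, one_mul]
        exact hr
      · have h3 := hc (e, !b) ⟨by simpa [target] using hb, by
          rw [← ha, ← h2]
          simp [stepRev, Orientation.arrow]⟩
        have h4 : (g e : ℤ) - ((W.map Prod.fst).count e : ℕ) = 0 := by
          have := hle e
          simp only at h3
          omega
        simp only [h4]
        simp
    · simp
  rw [boundary_sub, hg x, boundary_count_of_isChain hW hne, if_pos hx.symm, ← ha] at h1
  have h2 : (a : ℤ) * a = 1 := by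
    rw [← Units.val_mul, Int.units_mul_self, Units.val_one]
  by_cases ht : G.target (W.getLast hne) = x
  · have h3 : ε.arrow (stepRev (W.getLast hne)) = a :=
      (units_eq_or_eq_neg _ _).resolve_right fun h3 => hcl ⟨ht, h3⟩
    rw [if_pos ht, h3] at h1
    linarith
  · rw [if_neg ht] at h1
    linarith

theorem exists_isCircuit_le {g : E → ℕ} (hg : IsFlow ε fun e => (g e : ℤ)) (h0 : g ≠ 0) :
    ∃ W, IsCircuit ε W ∧ ∀ e, (W.map Prod.fst).count e ≤ g e := by
  by_contra! hc
  have key : ∀ l : ℕ, ∃ W : List (E × Bool), W.length = l + 1 ∧ W.IsChain (Follows ε) ∧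
      ∀ e, (W.map Prod.fst).count e ≤ g e := by
    intro l
    induction l with
    | zero =>
      obtain ⟨e, he⟩ := Function.ne_iff.mp h0
      refine ⟨[(e, false)], rfl, List.isChain_singleton _, fun e' => ?_⟩
      by_cases hee : e = e'
      · subst hee
        simpa using Nat.one_le_iff_ne_zero.mpr he
      · simp [hee]
    | succ l ih =>
      obtain ⟨W, hl, hW, hle⟩ := ih
      have hne : W ≠ [] := by
        rintro rfl
        simp at hl
      have hcl : ¬ Follows ε (W.getLast hne) (W.head hne) := by
        intro hcl
        obtain ⟨e, he⟩ := hc W ⟨hW, hne, hcl⟩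
        exact absurd (hle e) (not_le.mpr he)
      obtain ⟨d, hd, hlt⟩ := exists_follows_of_not_closed hg hW hne hle hcl
      refine ⟨d :: W, by simp [hl], ?_, fun e => ?_⟩
      · obtain ⟨d', W, rfl⟩ := List.exists_cons_of_ne_nil hne
        exact List.isChain_cons_cons.mpr ⟨hd, hW⟩
      · rw [List.map_cons, List.count_cons]
        by_cases hde : d.1 = e
        · subst hde
          simpa using hlt
        · simpa [hde] using hle e
  -- A walk longer than the total of `g` must exceed `g` on some edge.
  obtain ⟨W, hl, -, hle⟩ := key (∑ e, g e)
  have h1 : ∑ e, (W.map Prod.fst).count e = (W.map Prod.fst).length := by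
    have := Multiset.sum_count_eq_card (m := ((W.map Prod.fst : List E) : Multiset E))
      fun a _ => Finset.mem_univ a
    simpa only [Multiset.coe_count, Multiset.coe_card] using this
  have h2 : ∑ e, (W.map Prod.fst).count e ≤ ∑ e, g e := Finset.sum_le_sum fun e _ => hle e
  rw [h1, List.length_map] at h2
  omega

theorem IsMinimalFlow.count_eq {g : E → ℕ} (hg : IsMinimalFlow ε g) {W : List (E × Bool)}
    (hW : IsCircuit ε W) (hle : ∀ e, (W.map Prod.fst).count e ≤ g e) :
    (fun e => (W.map Prod.fst).count e) = g :=
  hg.minimal _ hW.isFlow (count_ne_zero hW.2.choose) hle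

/-- The counts over `A` form a flow below `g`: if zero then `A` is empty, and if equal to `g` then
`A` contains every occurrence of every edge. -/
theorem IsMinimalFlow.isMinimalCircuit {g : E → ℕ} (hg : IsMinimalFlow ε g) {W : List (E × Bool)}
    [NeZero W.length] (hW : IsCircuit ε W) (hcount : ∀ e, (W.map Prod.fst).count e = g e) :
    IsMinimalCircuit ε W.get := by
  obtain ⟨hc, hne, hcl⟩ := hW
  have hfol := isChain_cyclic hc hne hcl
  refine ⟨fun i => (hfol i).1, fun i => (hfol i).2, fun A hA => ?_⟩
  by_cases h0 : (fun e => (A.filter fun i => (W.get i).1 = e).card) = 0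
  · left
    rw [Finset.eq_empty_iff_forall_notMem]
    intro i hi
    have := congrFun h0 (W.get i).1
    rw [Pi.zero_apply, Finset.card_eq_zero] at this
    have h1 : i ∈ A.filter fun j => (W.get j).1 = (W.get i).1 := by simp [hi]
    rw [this] at h1
    exact Finset.notMem_empty _ h1
  · right
    have h1 := hg.minimal _ hA h0 fun e => by
      rw [← hcount, ← card_filter_get]
      exact Finset.card_le_card (Finset.filter_subset_filter _ (Finset.subset_univ A))
    rw [Finset.eq_univ_iff_forall]
    intro i
    have h2 := congrFun h1 (W.get i).1
    rw [← hcount, ← card_filter_get] at h2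
    have h3 := Finset.eq_of_subset_of_card_le
      (Finset.filter_subset_filter (fun j => (W.get j).1 = (W.get i).1) (Finset.subset_univ A)) h2.ge
    have h4 : i ∈ Finset.univ.filter fun j => (W.get j).1 = (W.get i).1 := by simp
    rw [← h3] at h4
    exact (Finset.mem_filter.mp h4).1

theorem IsMinimalFlow.isMinimalDirectedEulerianWalk {g : E → ℕ} (hg : IsMinimalFlow ε g)
    {W : List (E × Bool)} (hW : IsCircuit ε W) (hcount : ∀ e, (W.map Prod.fst).count e = g e) :
    G.IsMinimalDirectedEulerianWalk W (ε.onWalk W) := by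
  refine ⟨hW.isDirectedEulerianWalk, fun W' δ' hW' hP => ?_⟩
  obtain ⟨hlt, hδ⟩ := hP
  -- Every edge of the smaller walk occurs in `W`, so agreement of directions forces `δ'` to come
  -- from `ε`.
  have h1 : δ' = ε.onWalk W' := by
    funext i
    have h2 : (W'.get i).1 ∈ edgeMultiset W :=
      Multiset.mem_of_le hlt.le (List.mem_map_of_mem (List.get_mem W' i))
    obtain ⟨d, hd, hde⟩ := List.mem_map.mp h2
    obtain ⟨j, rfl⟩ := List.mem_iff_get.mp hd
    rw [hδ i j hde.symm]
    simp only [Orientation.onWalk, hde]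
  subst h1
  have h2 := hg.count_eq (isDirectedClosedWalk_onWalk_iff.mp hW'.2) fun e => by
    rw [← hcount]
    have := Multiset.count_le_of_le e hlt.le
    rwa [edgeMultiset, edgeMultiset, Multiset.coe_count, Multiset.coe_count] at this
  refine hlt.ne (Multiset.ext.mpr fun e => ?_)
  rw [edgeMultiset, edgeMultiset, Multiset.coe_count, Multiset.coe_count]
  exact (congrFun h2 e).trans (hcount e).symm

theorem IsMinimalFlow.exists_walk_cycleTree {g : E → ℕ} (hg : IsMinimalFlow ε g) :
    ∃ (W : List (E × Bool)) (T : CycleTree G), G.IsMinimalDirectedEulerianWalk W (ε.onWalk W) ∧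
      T.IsEulerian ∧ T.edges = walkSupport W ∧ (∀ e, (W.map Prod.fst).count e = g e) ∧
      ∀ e, T.indicator e = g e := by
  obtain ⟨W, hW, hle⟩ := exists_isCircuit_le hg.isFlow hg.ne_zero
  have hcount := congrFun (hg.count_eq hW hle)
  have := neZero_length hW.2.choose
  have hmin := hg.isMinimalCircuit hW hcount
  refine ⟨W, hmin.cycleTree, hg.isMinimalDirectedEulerianWalk hW hcount,
    hmin.cycleTree_isEulerian, ?_, hcount, fun e => ?_⟩
  · ext e
    rw [walkSupport, List.mem_toFinset, List.mem_map]
    refine mem_image_fst.trans ⟨?_, ?_⟩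
    · rintro ⟨i, rfl⟩
      exact ⟨_, List.get_mem W i, rfl⟩
    · rintro ⟨d, hd, rfl⟩
      obtain ⟨i, rfl⟩ := List.mem_iff_get.mp hd
      exact ⟨i, rfl⟩
  · rw [hmin.cycleTree_indicator, card_filter_get]
    exact congrArg _ (hcount e)

end NonnegativeFlows

/-! ### Passing between `f` and its absolute value. -/

section Reorientation

variable {V E : Type*} {G : SignedGraph V E}

theorem coupling_mul_self (ε ε' : G.Orientation) (e : E) :
    coupling ε ε' e * coupling ε ε' e = 1 := by
  rw [coupling, ← Units.val_mul, Int.units_mul_self, Units.val_one]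

theorem boundary_coupling_mul [Fintype E] [DecidableEq V] (ε ε' : G.Orientation) (f : E → ℤ)
    (u : V) : boundary ε (fun e => coupling ε ε' e * f e) u = boundary ε' f u := by
  unfold boundary
  refine Finset.sum_congr rfl fun e _ => Finset.sum_congr rfl fun b _ => ?_
  simp only [coupling_eq ε ε' e b]
  rw [← mul_assoc, ← Units.val_mul, ← mul_assoc, Int.units_mul_self, one_mul]

theorem eq_coupling_mul_natAbs (ε : G.Orientation) (f : E → ℤ) (e : E) :
    f e = coupling ε (flowOrientation ε f) e * (f e).natAbs := by
  unfold coupling flowOrientation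
  by_cases hf : f e < 0
  · simp only [hf, if_true, mul_neg, Int.units_mul_self, Units.val_neg, Units.val_one]
    omega
  · simp only [hf, if_false, Int.units_mul_self, Units.val_one]
    omega

theorem charVector_onWalk [DecidableEq E] (ε ε' : G.Orientation) (W : List (E × Bool)) (x : E) :
    charVector ε W (ε'.onWalk W) x = coupling ε ε' x * (W.map Prod.fst).count x := by
  rw [← card_filter_get, mul_comm, ← nsmul_eq_mul, ← Finset.sum_const, Finset.sum_filter]
  refine Finset.sum_congr rfl fun i _ => ?_
  split_ifs with h
  · rw [← h]
    rfl
  · rfl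

theorem isFlow_natAbs [Fintype E] [DecidableEq V] {ε : G.Orientation} {f : E → ℤ}
    (hf : IsFlow ε f) : IsFlow (flowOrientation ε f) fun e => ((f e).natAbs : ℤ) := by
  intro u
  rw [← boundary_coupling_mul ε]
  simp only [← eq_coupling_mul_natAbs]
  exact hf u

/-- A smaller flow `g` would split `|f|` as `g + (|f| - g)`. Multiplying both parts by the same
coupling decomposes `f`, and their pointwise product stays nonnegative. -/
theorem IsIndecomposable.isMinimalFlow [Fintype E] [DecidableEq V] {ε : G.Orientation} {f : E → ℤ}
    (hf : IsIndecomposable ε f) :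
    IsMinimalFlow (flowOrientation ε f) fun e => (f e).natAbs := by
  obtain ⟨⟨hflow, e, he⟩, hind⟩ := hf
  have hne : ∀ {g : E → ℕ}, IsFlow (flowOrientation ε f) (fun e => (g e : ℤ)) → g ≠ 0 →
      IsNontrivialFlow ε fun e => coupling ε (flowOrientation ε f) e * g e := by
    intro g hg hg0
    refine ⟨fun u => by rw [boundary_coupling_mul, hg u], ?_⟩
    obtain ⟨e, he⟩ := Function.ne_iff.mp hg0
    refine ⟨e, mul_ne_zero (fun h0 => ?_) (Nat.cast_ne_zero.mpr he)⟩
    have := coupling_mul_self ε (flowOrientation ε f) e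
    rw [h0] at this
    simp at this
  refine ⟨isFlow_natAbs hflow, fun h0 => he ?_, fun g hg hg0 hle => ?_⟩
  · simpa using congrFun h0 e
  · by_contra hgf
    refine hind ⟨_, _, hne hg hg0, hne (isFlow_sub (isFlow_natAbs hflow) hg hle) ?_, ?_, ?_⟩
    · intro h0
      exact hgf (le_antisymm hle (tsub_eq_zero_iff_le.mp h0))
    · funext e
      rw [Pi.add_apply, ← mul_add, Pi.sub_apply, Nat.cast_sub (hle e), add_sub_cancel]
      exact eq_coupling_mul_natAbs ε f e
    · intro e
      rw [mul_mul_mul_comm, coupling_mul_self, one_mul]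
      positivity

end Reorientation

end SignedGraph

/-! ### The Flow Reduction Theorem. -/

theorem mainTheorem2 {V E : Type*} [Fintype V] [Fintype E] [DecidableEq V] [DecidableEq E]
    (G : SignedGraph V E) (ε : G.Orientation) (f : E → ℤ)
    (hf : SignedGraph.IsNontrivialFlow ε f) :
    (∃ (k : ℕ) (W : Fin k → List (E × Bool)) (T : Fin k → SignedGraph.CycleTree G),
      (∀ i, G.IsMinimalDirectedEulerianWalk (W i)
          ((SignedGraph.flowOrientation ε f).onWalk (W i)) ∧
        (T i).IsEulerian ∧ (T i).edges = SignedGraph.walkSupport (W i)) ∧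
      (∀ x, f x = ∑ i, SignedGraph.charVector ε (W i)
          ((SignedGraph.flowOrientation ε f).onWalk (W i)) x) ∧
      (∀ x, f x = ∑ i, SignedGraph.coupling ε (SignedGraph.flowOrientation ε f) x *
          (T i).indicator x)) ∧
    (SignedGraph.IsIndecomposable ε f →
      ∃ (W : List (E × Bool)) (T : SignedGraph.CycleTree G),
        G.IsMinimalDirectedEulerianWalk W ((SignedGraph.flowOrientation ε f).onWalk W) ∧
        T.IsEulerian ∧ T.edges = SignedGraph.walkSupport W ∧
        (∀ x, f x = SignedGraph.charVector ε W ((SignedGraph.flowOrientation ε f).onWalk W) x) ∧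
        (∀ x, f x = SignedGraph.coupling ε (SignedGraph.flowOrientation ε f) x *
          T.indicator x)) := by
  have hflow := SignedGraph.isFlow_natAbs hf.1
  refine ⟨?_, fun hind => ?_⟩
  · obtain ⟨L, hL, hsum⟩ := SignedGraph.exists_sum_isMinimalFlow _ hflow
    choose W T hW hT hE hc hI using
      fun i : Fin L.length => (hL _ (List.get_mem L i)).exists_walk_cycleTree
    have key : ∀ x, f x = ∑ i : Fin L.length,
        SignedGraph.coupling ε (SignedGraph.flowOrientation ε f) x * (L.get i x : ℤ) := by
      intro x
      have h1 : (f x).natAbs = ∑ i : Fin L.length, L.get i x := by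
        rw [← Finset.sum_apply, ← List.sum_ofFn, List.ofFn_get]
        exact congrFun hsum x
      rw [SignedGraph.eq_coupling_mul_natAbs ε f x, h1, ← Finset.mul_sum, Nat.cast_sum]
    refine ⟨L.length, W, T, fun i => ⟨hW i, hT i, hE i⟩, fun x => ?_, fun x => ?_⟩
    · simp only [SignedGraph.charVector_onWalk, hc]
      exact key x
    · simp only [hI]
      exact key x
  · obtain ⟨W, T, hW, hT, hE, hc, hI⟩ := hind.isMinimalFlow.exists_walk_cycleTree
    refine ⟨W, T, hW, hT, hE, fun x => ?_, fun x => ?_⟩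
    · rw [SignedGraph.charVector_onWalk, hc]
      exact SignedGraph.eq_coupling_mul_natAbs ε f x
    · rw [hI]
      exact SignedGraph.eq_coupling_mul_natAbs ε f x
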